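/- **Setting.** Let $A'\in\mathbb R^{m'\times n'}$, $b'\in\mathbb R^{m'}$, $c'\in\mathbb R^{n'}$ be the data of the primal–dual pair $(P')$: $\min c'^Tx$, $A'x\ge b'$, $x\ge 0$, and $(D')$: $\max b'^Ty$, $A'^Ty\le c'$, $y\ge 0$. Put $N=n'+m'+2$, $\bar b=b'-A'e+e$, $\bar c=A'^Te+e-c'$, $\bar o=1+c'^Te-b'^Te$. The self-dual embedding is $$\min\ N\gamma\quad\text{s.t. } u=A'x-b'\tau+\bar b\gamma,\ \ s=-A'^Ty+c'\tau+\bar c\gamma,\ \ \phi=b'^Ty-c'^Tx+\bar o\gamma,\ \ \rho=-\bar b^Ty-\bar c^Tx-\bar o\tau+N,$$ with all of $y,x,\tau,\gamma,u,s,\phi,\rho\ge 0$. Write $\mathcal X=(w;z)$ with $w=(u;s;\phi;\rho)$, $z=(y;x;\tau;\gamma)$, and $\mu(\mathcal X)=z^Tw/N$. Let $\mathcal{PD}$ be the feasible set, $\mathcal{PD}_\zeta=\{\mathcal X\in\mathcal{PD}:\mu(\mathcal X)\le\zeta\}$, and $\mathcal N(\theta)=\{\mathcal X\in\mathcal{PD}: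 z,w>0,\ \|(z_iw_i-\mu)_i\|_2\le\theta\mu\}$. **Algorithm.** Let $\eta=0.1$, $\beta=1-0.11/\sqrt N$, and $\theta=0.2$ (IF-IPM) or $\theta=0.3$ (IF-QIPM). Let $\mathcal V$ be the matrix whose columns form the standard basis of the null space of the constraint matrix: writing the equalities as $w=Mz+q$, with $M$ skew-symmetric, $\mathcal V=\begin{bmatrix}-M\\-I\end{bmatrix}$. Let $\mathcal D=[\operatorname{diag}(z)\ \operatorname{diag}(w)]$ and $\mathcal R=\beta\mu e-(z_iw_i)_i$. Start at some $\mathcal X^0\in\mathcal N(\theta)$; in iteration $k$, solve the OSS system $\mathcal D\mathcal V\lambda=\mathcal R$ at $\mathcal X^k$ inexactly, obtaining $\tilde\lambda$ with residual $\|\mathcal D\mathcal V\tilde\lambda-\mathcal R\|_2\le\eta\mu_k$ or with error $\|\tilde\lambda-\lambda\|_2\le\eta\mu_k/\|\mathcal D\mathcal V\|_2$ from an exact solution $\lambda$, and set $\mathcal X^{k+1}=\mathcal X^k+\mathcal V\tilde\lambda$. Write $\mu_k=\mu(\mathcal X^k)$. (A stopping test $\mathcal X^k\in\mathcal{PD}_\zeta$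 only truncates this sequence.) **Theorem.** There is an absolute constant $C>0$ such that for both values of $\theta$ and all $m',n',A',b',c'$ the following holds. The all-one vector lies in $\mathcal N(\theta)$ and has $\mu=1$; an iteration can be performed from every point of $\mathcal N(\theta)$; and for every sequence $(\mathcal X^k)_{k\ge0}$ produced as above: 1. $\mu_k\to0$ linearly, with $\mu_{k+1}\le(1-\tfrac{0.01}{\sqrt N})\mu_k$ for all $k$. 2. $\mathcal X^k\in\mathcal N(\theta)$ for all $k$. 3. Let $\kappa$ satisfy $n'+m'+2\le\kappa n'$, and let $\zeta>0$. Then $\mathcal X^k\in\mathcal{PD}_\zeta$ for every integer $k\ge C\sqrt{\kappa}\,\sqrt{n'}\,\log(\mu_0/\zeta)$. If $\mu_0\le1$ (in particular, if the start is the all-one vector), then $\mathcal X^k\in\mathcal{PD}_\zeta$ for every integer $k\ge C\sqrt{\kappa}\,\sqrt{n'}\,\log(1/\zeta)$. That is, $O(\sqrt{n'}\log(1/\zeta))$ iterations suffice when $m'=O(n')$, and $O(\sqrt{n'+m'+2}\,\log(1/\zeta))$ in general for $n'\ge1$. 4. Suppose moreover that $\mu_0\le 1$ and that $A',b',c'$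 are integral, of binary length $$L=m'n'+m'+n'+\sum_{i,j}\lceil\log_2(|a'_{ij}|+1)\rceil+\sum_j\lceil\log_2(|c'_j|+1)\rceil+\sum_i\lceil\log_2(|b'_i|+1)\rceil.$$ Then for every integer $k\ge C\sqrt{\kappa}\,\sqrt{n'}\,L$, rounding $\mathcal X^k$ gives an exact optimal solution. Precisely, consider the affine set of all $(w;z)$ that satisfy the equality constraints of the embedding, $z_i=0$ whenever $z^k_i\le w^k_i$, and $w_i=0$ whenever $z^k_i>w^k_i$. Then this set has a unique point $(w^*;z^*)$ nearest to $\mathcal X^k$ in Euclidean norm, and this point is a strictly complementary optimal solution of the embedding. If $\tau^*>0$, then $x^*/\tau^*$ and $y^*/\tau^*$ are optimal for $(P')$ and $(D')$; if $\tau^*=0$, then $(P')$ or $(D')$ is infeasible. -/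

import Mathlib

open Filter Topology

noncomputable section

namespace SelfDual

/-- Index set of the four blocks `(y, x, τ, γ)` (equally of `(u, s, φ, ρ)`), with `y, u ∈ ℝ^m`,
`x, s ∈ ℝ^n` and `τ, γ, φ, ρ ∈ ℝ`. -/
abbrev Idx (m n : ℕ) : Type := Fin m ⊕ (Fin n ⊕ (Unit ⊕ Unit))

/-- Position of `τ` (and of its slack `φ`). -/
def iTau (m n : ℕ) : Idx m n := Sum.inr (Sum.inr (Sum.inl ()))

/-- Position of `γ` (and of its slack `ρ`). -/
def iGam (m n : ℕ) : Idx m n := Sum.inr (Sum.inr (Sum.inr ()))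

/-- A vector `𝒳 = (u; s; φ; ρ; y; x; τ; γ)`. The left half holds the slacks. -/
abbrev Point (m n : ℕ) : Type := Idx m n ⊕ Idx m n → ℝ

/-- The block `w = (u; s; φ; ρ)` of `𝒳`. -/
def slk {m n : ℕ} (Z : Point m n) : Idx m n → ℝ := fun i => Z (Sum.inl i)

/-- The block `z = (y; x; τ; γ)` of `𝒳`. -/
def var {m n : ℕ} (Z : Point m n) : Idx m n → ℝ := fun i => Z (Sum.inr i)

/-- The `x`-part of `𝒳`. -/
def xPart {m n : ℕ} (Z : Point m n) : Fin n → ℝ := fun j => var Z (Sum.inr (Sum.inl j))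

/-- The `y`-part of `𝒳`. -/
def yPart {m n : ℕ} (Z : Point m n) : Fin m → ℝ := fun i => var Z (Sum.inl i)

/-- Size `n + m + 2` of the embedding. -/
def dim (m n : ℕ) : ℝ := (n : ℝ) + m + 2

/-- Euclidean norm of a real vector. -/
def norm2 {ι : Type} [Fintype ι] (v : ι → ℝ) : ℝ := Real.sqrt (∑ i, v i ^ 2)

section Embedding

variable {m n : ℕ} (A : Matrix (Fin m) (Fin n) ℝ) (b : Fin m → ℝ) (c : Fin n → ℝ)

/-- `b̄ = b - A e + e`. -/
def bBar : Fin m → ℝ := fun i => b i - (∑ j, A i j) + 1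

/-- `c̄ = Aᵀ e + e - c`. -/
def cBar : Fin n → ℝ := fun j => (∑ i, A i j) + 1 - c j

/-- `ō = 1 + cᵀ e - bᵀ e`. -/
def oBar : ℝ := 1 + (∑ j, c j) - ∑ i, b i

/-- The skew-symmetric coefficient matrix of the self-dual model, rows and columns ordered as
`(y, x, τ, γ)`:
`[0, A, -b, b̄; -Aᵀ, 0, c, c̄; bᵀ, -cᵀ, 0, ō; -b̄ᵀ, -c̄ᵀ, -ō, 0]`. -/
def sdMatrix : Matrix (Idx m n) (Idx m n) ℝ := Matrix.of fun p q =>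
  match p, q with
  | Sum.inl i, Sum.inr (Sum.inl j) => A i j
  | Sum.inl i, Sum.inr (Sum.inr (Sum.inl _)) => -b i
  | Sum.inl i, Sum.inr (Sum.inr (Sum.inr _)) => bBar A b i
  | Sum.inr (Sum.inl j), Sum.inl i => -A i j
  | Sum.inr (Sum.inl j), Sum.inr (Sum.inr (Sum.inl _)) => c j
  | Sum.inr (Sum.inl j), Sum.inr (Sum.inr (Sum.inr _)) => cBar A c j
  | Sum.inr (Sum.inr (Sum.inl _)), Sum.inl i => b i
  | Sum.inr (Sum.inr (Sum.inl _)), Sum.inr (Sum.inl j) => -c j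
  | Sum.inr (Sum.inr (Sum.inl _)), Sum.inr (Sum.inr (Sum.inr _)) => oBar b c
  | Sum.inr (Sum.inr (Sum.inr _)), Sum.inl i => -bBar A b i
  | Sum.inr (Sum.inr (Sum.inr _)), Sum.inr (Sum.inl j) => -cBar A c j
  | Sum.inr (Sum.inr (Sum.inr _)), Sum.inr (Sum.inr (Sum.inl _)) => -oBar b c
  | _, _ => 0

/-- The vector `(0; 0; 0; n + m + 2)`. -/
def sdRhs (m n : ℕ) : Idx m n → ℝ := fun p => if p = iGam m n then dim m n else 0

/-- The equality constraints of the self-dual model with slacks: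
`u = A x - b τ + b̄ γ`, `s = -Aᵀ y + c τ + c̄ γ`, `φ = bᵀ y - cᵀ x + ō γ`,
`ρ = -b̄ᵀ y - c̄ᵀ x - ō τ + (n + m + 2)`. -/
def SatisfiesEqs (Z : Point m n) : Prop :=
  slk Z = (sdMatrix A b c).mulVec (var Z) + sdRhs m n

/-- The feasible set `𝒫𝒟` of the self-dual model. -/
def feasible : Set (Point m n) :=
  {Z | SatisfiesEqs A b c Z ∧ (∀ i, 0 ≤ var Z i) ∧ ∀ i, 0 ≤ slk Z i}

/-- The interior feasible set `𝒫𝒟⁰`. -/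
def interiorFeasible : Set (Point m n) :=
  {Z | Z ∈ feasible A b c ∧ (∀ i, 0 < var Z i) ∧ ∀ i, 0 < slk Z i}

/-- `μ = (xᵀ s + yᵀ u + τ φ + γ ρ) / (n + m + 2)`. -/
def mu (Z : Point m n) : ℝ := (∑ i, var Z i * slk Z i) / dim m n

/-- The set `𝒫𝒟_ζ` of `ζ`-optimal solutions. -/
def zetaOptimal (ζ : ℝ) : Set (Point m n) := {Z | Z ∈ feasible A b c ∧ mu Z ≤ ζ}

/-- The neighborhood `𝒩(θ)` of the central path. -/
def nbhd (θ : ℝ) : Set (Point m n) :=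
  {Z | Z ∈ interiorFeasible A b c ∧
    norm2 (fun i => var Z i * slk Z i - mu Z) ≤ θ * mu Z}

/-- The starting point in which all components are one. -/
def ones (m n : ℕ) : Point m n := fun _ => 1

/-- The matrix `𝒱`, whose columns form a basis of the null space of the constraint matrix
acting on `(u; s; φ; ρ; y; x; τ; γ)`: the negative of `sdMatrix` on top of `-I`. -/
def calV : Matrix (Idx m n ⊕ Idx m n) (Idx m n) ℝ :=
  Matrix.fromRows (-sdMatrix A b c) (-1)

/-- The matrix `𝒟`, i.e. `diag (y; x; τ; γ)` followed by `diag (u; s; φ; ρ)`. -/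
def calD (Z : Point m n) : Matrix (Idx m n) (Idx m n ⊕ Idx m n) ℝ :=
  Matrix.fromCols (Matrix.diagonal (var Z)) (Matrix.diagonal (slk Z))

/-- `η = 0.1`. -/
def eta : ℝ := 1 / 10

/-- `β = 1 - 0.11 / √(n + m + 2)`. -/
def beta (m n : ℕ) : ℝ := 1 - (11 / 100) / Real.sqrt (dim m n)

/-- The right-hand side `ℛ = β μ e - (Y u; X s; τ φ; γ ρ)`. -/
def calR (Z : Point m n) : Idx m n → ℝ := fun i => beta m n * mu Z - var Z i * slk Z i

/-- The coefficient matrix `𝒟𝒱` of the orthogonal subspaces system `𝒟𝒱 lam = ℛ`. -/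
def oss (Z : Point m n) : Matrix (Idx m n) (Idx m n) ℝ := calD Z * calV A b c

/-- `lam` is accepted as an inexact solution of the orthogonal subspaces system at `Z`: either its
residual is at most `η μ`, or its distance to an exact solution is at most `η μ / ‖𝒟𝒱‖₂`
(spectral norm). -/
def Accepted (Z : Point m n) (lam : Idx m n → ℝ) : Prop :=
  norm2 ((oss A b c Z).mulVec lam - calR Z) ≤ eta * mu Z ∨
  ∃ lamEx : Idx m n → ℝ, (oss A b c Z).mulVec lamEx = calR Z ∧
    norm2 (lam - lamEx) ≤ eta * mu Z / ‖Matrix.toEuclideanCLM (𝕜 := ℝ) (oss A b c Z)‖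

/-- One pass of the loop: solve the orthogonal subspaces system inexactly, then take the full
step `Δ𝒳 = 𝒱 lam`. -/
def Step (Z Znext : Point m n) : Prop :=
  ∃ lam : Idx m n → ℝ, Accepted A b c Z lam ∧ Znext = Z + (calV A b c).mulVec lam

/-- A sequence of iterates: it starts at some point of `𝒩(θ)` and repeats the loop body. -/
def IsRun (θ : ℝ) (X : ℕ → Point m n) : Prop :=
  X 0 ∈ nbhd A b c θ ∧ ∀ k, Step A b c (X k) (X (k + 1))

/-- The affine set of all points that satisfy the equality constraints, have `z_i = 0` where
`z_i ≤ w_i` holds at `Z`, and have `w_i = 0` where `z_i > w_i` holds at `Z`. -/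
def guessedFace (Z : Point m n) : Set (Point m n) :=
  {P | SatisfiesEqs A b c P ∧
    ∀ i, (var Z i ≤ slk Z i → var P i = 0) ∧ (slk Z i < var Z i → slk P i = 0)}

/-- `P` is the rounding of `Z`: a point of the affine set `guessedFace` nearest to `Z` in the
Euclidean norm. -/
def IsRounding (Z P : Point m n) : Prop :=
  P ∈ guessedFace A b c Z ∧ ∀ Q ∈ guessedFace A b c Z, norm2 (P - Z) ≤ norm2 (Q - Z)

/-- `P` is a strictly complementary (exact) optimal solution of the self-dual model
`min (n + m + 2) γ`. -/
def IsStrictOptimal (P : Point m n) : Prop :=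
  P ∈ feasible A b c ∧
  (∀ Q ∈ feasible A b c,
    dim m n * var P (iGam m n) ≤ dim m n * var Q (iGam m n)) ∧
  ∀ i, var P i * slk P i = 0 ∧ 0 < var P i + slk P i

/-- Feasible set of the primal problem `min cᵀ x`, `A x ≥ b`, `x ≥ 0`. -/
def primalFeasible : Set (Fin n → ℝ) := {x | (∀ i, b i ≤ A.mulVec x i) ∧ ∀ j, 0 ≤ x j}

/-- Feasible set of the dual problem `max bᵀ y`, `Aᵀ y ≤ c`, `y ≥ 0`. -/
def dualFeasible : Set (Fin m → ℝ) :=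
  {y | (∀ j, A.transpose.mulVec y j ≤ c j) ∧ ∀ i, 0 ≤ y i}

/-- `x` is an optimal solution of the primal problem. -/
def IsPrimalOptimal (x : Fin n → ℝ) : Prop :=
  x ∈ primalFeasible A b ∧ ∀ v ∈ primalFeasible A b, c ⬝ᵥ x ≤ c ⬝ᵥ v

/-- `y` is an optimal solution of the dual problem. -/
def IsDualOptimal (y : Fin m → ℝ) : Prop :=
  y ∈ dualFeasible A c ∧ ∀ v ∈ dualFeasible A c, b ⬝ᵥ v ≤ b ⬝ᵥ y

end Embedding

/-- Binary length of integer data: `mn + m + n + ∑ ⌈log₂(|a_ij| + 1)⌉ + ∑ ⌈log₂(|c_j| + 1)⌉ +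
∑ ⌈log₂(|b_i| + 1)⌉`. Here `Nat.clog 2 t` is `⌈log₂ t⌉`. -/
def binaryLength {m n : ℕ} (A : Matrix (Fin m) (Fin n) ℤ) (b : Fin m → ℤ) (c : Fin n → ℤ) : ℕ :=
  m * n + m + n + (∑ i, ∑ j, Nat.clog 2 ((A i j).natAbs + 1))
    + (∑ j, Nat.clog 2 ((c j).natAbs + 1)) + ∑ i, Nat.clog 2 ((b i).natAbs + 1)

end SelfDual

end

/-! Every step lies in the range of `calV`, the null space of the equalities, so inexact solves keep
the equalities exactly and disturb only the products `z_i w_i`. Skew symmetry makes `dz` and `dw`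
orthogonal. Hence the new `μ` is `(1 - 0.11/√N) μ` plus the mean of the residual, which
Cauchy–Schwarz bounds by `0.1 μ/√N`; the decrease `0.01/√N` remains. The deviation of the products
from their mean comes from the centred residual and from `dz dw`, which is quadratically small, so
the neighbourhood is preserved (`inexact_step`). The iteration bounds follow from `1 - t ≤ exp
(-t)`.

Skew symmetry also gives `μ = γ`. For two solutions of the equalities it gives `(z - z')ᵀ(w - w') =
0`. Against the all-one point this bounds the iterates; against an optimal point it is the cross
identity `z'ᵀw + w'ᵀz = N μ`. Since the ratios `z_i w_i / μ` stay near 1, dividing the cross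
identity by `μ` and passing to the limit shows that a limit point is strictly complementary
(`exists_strictly_complementary`).

For integral data, Cramer's rule with a minor bound `Δ` makes each coordinate that can be positive
at an optimum at least `1/Δ` at some optimum. By the cross identity its partner in an iterate is at
most `N Δ μ`, and centrality keeps the coordinate itself at least `(1 - θ)/(N Δ)`. Once `μ` is
small, comparing `z_i` with `w_i` therefore reads off the optimal partition. A Cramer-type error
bound puts a point of the affine hull of the optimal face so near the iterate that the projection
keeps all supported coordinates positive (`rounding_isStrictOptimal`). Since `Δ ≤ 2^(7L)`, a
multiple of `√N L` iterations is enough. -/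

namespace SelfDual

/-! ### Euclidean estimates and the effect of one inexact step. -/

section Norm

variable {ι : Type} [Fintype ι]

lemma norm2_eq_norm (v : ι → ℝ) : norm2 v = ‖WithLp.toLp 2 v‖ := by
  simp [norm2, EuclideanSpace.norm_eq]

lemma norm2_nonneg (v : ι → ℝ) : 0 ≤ norm2 v := Real.sqrt_nonneg _

lemma norm2_sq (v : ι → ℝ) : norm2 v ^ 2 = ∑ i, v i ^ 2 :=
  Real.sq_sqrt (Finset.sum_nonneg fun _ _ => sq_nonneg _)

lemma norm2_le_of_sum_sq_le {v : ι → ℝ} {a : ℝ} (ha : 0 ≤ a) (h : ∑ i, v i ^ 2 ≤ a ^ 2) :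
    norm2 v ≤ a := by
  rw [← norm2_sq] at h
  exact (sq_le_sq₀ (norm2_nonneg v) ha).1 h

lemma norm2_add_le (v v' : ι → ℝ) : norm2 (v + v') ≤ norm2 v + norm2 v' := by
  simp only [norm2_eq_norm, WithLp.toLp_add]
  exact norm_add_le _ _

lemma abs_le_norm2 (v : ι → ℝ) (i : ι) : |v i| ≤ norm2 v := by
  refine Real.abs_le_sqrt ?_
  exact Finset.single_le_sum (f := fun i => v i ^ 2) (fun j _ => sq_nonneg _) (Finset.mem_univ i)

lemma norm2_le_card_mul {v : ι → ℝ} {a : ℝ} (ha : 0 ≤ a) (h : ∀ i, |v i| ≤ a) :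
    norm2 v ≤ Fintype.card ι * a := by
  refine norm2_le_of_sum_sq_le (by positivity) ?_
  calc ∑ i, v i ^ 2 ≤ ∑ _i : ι, a ^ 2 :=
        Finset.sum_le_sum fun i _ => by
          rw [← sq_abs]
          exact pow_le_pow_left₀ (abs_nonneg _) (h i) 2
    _ = Fintype.card ι * a ^ 2 := by simp
    _ ≤ (Fintype.card ι * a) ^ 2 := by
        rw [mul_pow]
        refine mul_le_mul_of_nonneg_right ?_ (sq_nonneg a)
        exact_mod_cast Nat.le_self_pow two_ne_zero _

lemma norm2_mulVec_le [DecidableEq ι] (B : Matrix ι ι ℝ) (v : ι → ℝ) :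
    norm2 (B.mulVec v) ≤ ‖Matrix.toEuclideanCLM (𝕜 := ℝ) B‖ * norm2 v := by
  rw [norm2_eq_norm, norm2_eq_norm, ← Matrix.toEuclideanCLM_toLp]
  exact ContinuousLinearMap.le_opNorm _ _

/-- If `z dw` and `w dz` sum to `p` and `dz ⊥ dw`, then `‖dz dw‖ ≤ ‖p‖² / (2 l)` for every lower
bound `l` of the products `z w`. -/
lemma norm2_mul_le_of_orthogonal {z w dz dw : ι → ℝ} {l : ℝ} (hl : 0 < l)
    (hz : ∀ i, 0 < z i) (hw : ∀ i, 0 < w i) (hzw : ∀ i, l ≤ z i * w i)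
    (horth : ∑ i, dz i * dw i = 0) :
    norm2 (fun i => dz i * dw i) ≤
      norm2 (fun i => z i * dw i + w i * dz i) ^ 2 / (2 * l) := by
  -- With the scaling `√(z/w)`, `U` and `V` are the squared norms of the scaled `dw` and `dz`. The
  -- product of their `i`-th terms is `(dz_i dw_i)²`, and by orthogonality `U + V` is the squared
  -- norm of the sum of the scaled directions.
  set U := ∑ i, z i / w i * dw i ^ 2
  set V := ∑ i, w i / z i * dz i ^ 2
  have hu : ∀ i, 0 ≤ z i / w i * dw i ^ 2 := fun i =>
    mul_nonneg (div_pos (hz i) (hw i)).le (sq_nonneg _)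
  have hv : ∀ i, 0 ≤ w i / z i * dz i ^ 2 := fun i =>
    mul_nonneg (div_pos (hw i) (hz i)).le (sq_nonneg _)
  have hU : 0 ≤ U := Finset.sum_nonneg fun i _ => hu i
  have hV : 0 ≤ V := Finset.sum_nonneg fun i _ => hv i
  have h1 : ∑ i, (dz i * dw i) ^ 2 ≤ ((U + V) / 2) ^ 2 := by
    have : ∑ i, (dz i * dw i) ^ 2 ≤ U * V := by
      calc ∑ i, (dz i * dw i) ^ 2
          = ∑ i, (z i / w i * dw i ^ 2) * (w i / z i * dz i ^ 2) := by
            refine Finset.sum_congr rfl fun i _ => ?_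
            have := (hz i).ne'
            have := (hw i).ne'
            field_simp
        _ ≤ ∑ i, U * (w i / z i * dz i ^ 2) := by
            refine Finset.sum_le_sum fun i _ => mul_le_mul_of_nonneg_right ?_ (hv i)
            exact Finset.single_le_sum (f := fun i => z i / w i * dw i ^ 2)
              (fun j _ => hu j) (Finset.mem_univ i)
        _ = U * V := by rw [← Finset.mul_sum]
    nlinarith [sq_nonneg (U - V)]
  have h2 : U + V ≤ norm2 (fun i => z i * dw i + w i * dz i) ^ 2 / l := by
    have : U + V = ∑ i, (z i * dw i + w i * dz i) ^ 2 / (z i * w i) := by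
      have h3 : U + V = U + V + 2 * ∑ i, dz i * dw i := by rw [horth]; ring
      rw [h3, Finset.mul_sum, ← Finset.sum_add_distrib, ← Finset.sum_add_distrib]
      refine Finset.sum_congr rfl fun i _ => ?_
      have := (hz i).ne'
      have := (hw i).ne'
      field_simp
      ring
    rw [this, norm2_sq, Finset.sum_div]
    exact Finset.sum_le_sum fun i _ => div_le_div_of_nonneg_left (sq_nonneg _) hl (hzw i)
  refine norm2_le_of_sum_sq_le (by positivity) (h1.trans ?_)
  refine pow_le_pow_left₀ (by positivity) ?_ 2
  rw [mul_comm 2 l, ← div_div]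
  linarith

/-- Effect of one inexact step on the products `z w`. -/
lemma inexact_step {z w dz dw : ι → ℝ} {μ θ g s : ℝ} (hs2 : s ^ 2 = Fintype.card ι)
    (hs : 1.414 ≤ s) (hμ : 0 < μ) (hθ : 0 ≤ θ) (hθ1 : θ < 1) (hg : 0 ≤ g)
    (hg2 : θ ^ 2 + (11 / 100) ^ 2 ≤ g ^ 2)
    (hgθ : 1 / 10 + (g + 1 / 10) ^ 2 / (2 * (1 - θ)) ≤ θ * (1 - 21 / 141.4))
    (hz : ∀ i, 0 < z i) (hw : ∀ i, 0 < w i)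
    (hsum : ∑ i, z i * w i = Fintype.card ι * μ)
    (hnb : norm2 (fun i => z i * w i - μ) ≤ θ * μ)
    (horth : ∑ i, dz i * dw i = 0)
    (hr : norm2 (fun i => z i * dw i + w i * dz i - ((1 - (11 / 100) / s) * μ - z i * w i))
      ≤ 1 / 10 * μ) :
    ∃ μ' : ℝ, ∑ i, (z i + dz i) * (w i + dw i) = Fintype.card ι * μ' ∧ 0 < μ' ∧
      μ' ≤ (1 - (1 / 100) / s) * μ ∧
      norm2 (fun i => (z i + dz i) * (w i + dw i) - μ') ≤ θ * μ' ∧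
      (∀ i, 0 < z i + dz i) ∧ ∀ i, 0 < w i + dw i := by
  have hs0 : 0 < s := by linarith
  set t := 1 / s with ht
  have ht0 : 0 < t := by positivity
  have hts : t * s = 1 := by rw [ht]; field_simp
  have ht1 : t ≤ 1 / 1.414 := one_div_le_one_div_of_le (by norm_num) hs
  have hcard : (Fintype.card ι : ℝ) * t ^ 2 = 1 := by
    rw [← hs2, ← mul_pow, mul_comm, hts, one_pow]
  have e1 : (11 / 100) / s = 11 / 100 * t := by rw [ht]; ring
  have e2 : (1 / 100) / s = 1 / 100 * t := by rw [ht]; ring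
  rw [e1] at hr
  rw [e2]
  set r : ι → ℝ := fun i => z i * dw i + w i * dz i - ((1 - 11 / 100 * t) * μ - z i * w i)
  have hrsq : ∑ i, r i ^ 2 ≤ (1 / 10 * μ) ^ 2 := by
    rw [← norm2_sq]
    exact pow_le_pow_left₀ (norm2_nonneg _) hr 2
  have hcs : (∑ i, r i) ^ 2 ≤ (s * (1 / 10 * μ)) ^ 2 := by
    have := sq_sum_le_card_mul_sum_sq (s := Finset.univ) (f := r)
    rw [Finset.card_univ, ← hs2] at this
    rw [mul_pow]
    exact this.trans (mul_le_mul_of_nonneg_left hrsq (sq_nonneg s))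
  have hsr := abs_le_of_sq_le_sq' hcs (by positivity)
  -- As `t² = 1/N`, this is the mean of the residual; Cauchy–Schwarz bounds it by `0.1 μ t`.
  set ρ := (∑ i, r i) * t ^ 2 with hρ
  have hρsum : ∑ i, r i = Fintype.card ι * ρ := by
    rw [hρ]; linear_combination -(∑ i, r i) * hcard
  have hρle : ρ ≤ 1 / 10 * μ * t := by
    have h := mul_le_mul_of_nonneg_right hsr.2 (sq_nonneg t)
    calc ρ ≤ _ := h
      _ = 1 / 10 * μ * t * (t * s) := by ring
      _ = _ := by rw [hts, mul_one]
  have hρge : -(1 / 10 * μ * t) ≤ ρ := by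
    have h := mul_le_mul_of_nonneg_right hsr.1 (sq_nonneg t)
    calc -(1 / 10 * μ * t) = -(1 / 10 * μ * t * (t * s)) := by rw [hts, mul_one]
      _ = -(s * (1 / 10 * μ)) * t ^ 2 := by ring
      _ ≤ _ := h
  have hprod : ∀ i, (z i + dz i) * (w i + dw i) = (1 - 11 / 100 * t) * μ + r i + dz i * dw i :=
    fun i => by simp only [r]; ring
  have hμt : 0 ≤ μ * t := by positivity
  have hμtle : μ * t ≤ μ * (1 / 1.414) := mul_le_mul_of_nonneg_left ht1 hμ.le
  have hzwl : ∀ i, (1 - θ) * μ ≤ z i * w i := fun i => by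
    have := (abs_le_norm2 (fun i => z i * w i - μ) i).trans hnb
    rw [abs_le] at this
    linarith [this.1]
  set μ' := (1 - 11 / 100 * t) * μ + ρ with hμ'
  -- `0.21 = 0.11 + 0.1`, and `t ≤ 1/1.414`.
  have hμ'ge : (1 - 21 / 141.4) * μ ≤ μ' := by rw [hμ']; linarith
  have hμ'pos : 0 < μ' := lt_of_lt_of_le (by positivity) hμ'ge
  -- the norm of the scaled direction
  have hp : norm2 (fun i => z i * dw i + w i * dz i) ≤ (g + 1 / 10) * μ := by
    -- The deviations from `μ` are orthogonal to the constant vector, so the centring error `θ μ`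
    -- and the shift `0.11 μ` add in squares, not linearly.
    have h0 : ∑ i, (z i * w i - μ) = 0 := by
      rw [Finset.sum_sub_distrib, hsum]; simp
    have h1 : norm2 (fun i => (1 - 11 / 100 * t) * μ - z i * w i) ≤ g * μ := by
      refine norm2_le_of_sum_sq_le (by positivity) ?_
      have h2 : ∑ i, (z i * w i - μ) ^ 2 ≤ (θ * μ) ^ 2 := by
        rw [← norm2_sq (fun i => z i * w i - μ)]
        exact pow_le_pow_left₀ (norm2_nonneg _) hnb 2
      calc ∑ i, ((1 - 11 / 100 * t) * μ - z i * w i) ^ 2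
          = ∑ i, ((z i * w i - μ) ^ 2 + 2 * (11 / 100 * t * μ) * (z i * w i - μ)
              + (11 / 100 * t * μ) ^ 2) := Finset.sum_congr rfl fun i _ => by ring
        _ = ∑ i, (z i * w i - μ) ^ 2 + (11 / 100) ^ 2 * μ ^ 2 := by
            rw [Finset.sum_add_distrib, Finset.sum_add_distrib, ← Finset.mul_sum, h0]
            simp only [Finset.sum_const, Finset.card_univ, nsmul_eq_mul]
            linear_combination (11 / 100) ^ 2 * μ ^ 2 * hcard
        _ ≤ (θ ^ 2 + (11 / 100) ^ 2) * μ ^ 2 := by linarith [mul_pow θ μ 2]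
        _ ≤ (g * μ) ^ 2 := by
            rw [mul_pow]
            exact mul_le_mul_of_nonneg_right hg2 (sq_nonneg μ)
    have h3 : (fun i => z i * dw i + w i * dz i) =
        (fun i => (1 - 11 / 100 * t) * μ - z i * w i) + r := by
      funext i; simp [r]
    rw [h3]
    linarith [norm2_add_le (fun i => (1 - 11 / 100 * t) * μ - z i * w i) r]
  have ha : norm2 (fun i => dz i * dw i) ≤ (g + 1 / 10) ^ 2 / (2 * (1 - θ)) * μ := by
    have hθ' : 0 < 1 - θ := by linarith
    refine (norm2_mul_le_of_orthogonal (l := (1 - θ) * μ) (by positivity) hz hw hzwl horth).trans ?_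
    calc norm2 (fun i => z i * dw i + w i * dz i) ^ 2 / (2 * ((1 - θ) * μ))
        ≤ ((g + 1 / 10) * μ) ^ 2 / (2 * ((1 - θ) * μ)) :=
          div_le_div_of_nonneg_right (pow_le_pow_left₀ (norm2_nonneg _) hp 2) (by positivity)
      _ = _ := by field_simp
  -- Subtracting the mean does not increase the norm.
  have hrc : norm2 (fun i => r i - ρ) ≤ 1 / 10 * μ := by
    refine norm2_le_of_sum_sq_le (by positivity) (le_trans ?_ hrsq)
    calc ∑ i, (r i - ρ) ^ 2 = ∑ i, (r i ^ 2 - 2 * ρ * r i + ρ ^ 2) :=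
          Finset.sum_congr rfl fun i _ => by ring
      _ = ∑ i, r i ^ 2 - Fintype.card ι * ρ ^ 2 := by
          rw [Finset.sum_add_distrib, Finset.sum_sub_distrib, ← Finset.mul_sum, hρsum]
          simp only [Finset.sum_const, Finset.card_univ, nsmul_eq_mul]
          ring
      _ ≤ ∑ i, r i ^ 2 := by
          have : (0 : ℝ) ≤ Fintype.card ι * ρ ^ 2 := by positivity
          linarith
  have hnb' : norm2 (fun i => (z i + dz i) * (w i + dw i) - μ') ≤ θ * μ' := by
    have h3 : (fun i => (z i + dz i) * (w i + dw i) - μ') =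
        (fun i => r i - ρ) + (fun i => dz i * dw i) := by
      funext i; simp only [hprod, hμ', Pi.add_apply]; ring
    rw [h3]
    calc _ ≤ _ := norm2_add_le _ _
      _ ≤ 1 / 10 * μ + (g + 1 / 10) ^ 2 / (2 * (1 - θ)) * μ := add_le_add hrc ha
      _ = (1 / 10 + (g + 1 / 10) ^ 2 / (2 * (1 - θ))) * μ := by ring
      _ ≤ θ * (1 - 21 / 141.4) * μ := mul_le_mul_of_nonneg_right hgθ hμ.le
      _ ≤ θ * μ' := by
          rw [mul_assoc]
          exact mul_le_mul_of_nonneg_left hμ'ge hθ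
  have hpos : ∀ i, 0 < (z i + dz i) * (w i + dw i) := fun i => by
    have := (abs_le_norm2 (fun i => (z i + dz i) * (w i + dw i) - μ') i).trans hnb'
    rw [abs_le] at this
    have h := mul_pos (sub_pos.2 hθ1) hμ'pos
    linarith [this.1]
  -- A positive product still allows two negative factors; this positive combination of the factors
  -- excludes that, without a line search.
  have hmix : ∀ i, 0 < z i * (w i + dw i) + w i * (z i + dz i) := fun i => by
    have h1 := (abs_le_norm2 r i).trans hr
    rw [abs_le] at h1
    have h2 : z i * (w i + dw i) + w i * (z i + dz i) =
      z i * w i + (1 - 11 / 100 * t) * μ + r i := by simp only [r]; ring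
    rw [h2]
    linarith [h1.1, mul_pos (hz i) (hw i)]
  refine ⟨μ', ?_, hμ'pos, by rw [hμ']; linarith, hnb', fun i => ?_, fun i => ?_⟩
  · simp only [hprod, Finset.sum_add_distrib, horth, hρsum, hμ']
    simp only [Finset.sum_const, Finset.card_univ, nsmul_eq_mul]
    ring
  all_goals
    rcases mul_pos_iff.1 (hpos i) with h | h
    · first | exact h.1 | exact h.2
    · have := hmix i
      linarith [mul_neg_of_pos_of_neg (hz i) h.2, mul_neg_of_pos_of_neg (hw i) h.1]

end Norm

/-! ### Identities of the self-dual embedding and a single iteration. -/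

section Embedding

variable {m n : ℕ} {A : Matrix (Fin m) (Fin n) ℝ} {b : Fin m → ℝ} {c : Fin n → ℝ}

lemma card_idx (m n : ℕ) : (Fintype.card (Idx m n) : ℝ) = dim m n := by
  simp [dim]; ring

lemma two_le_dim (m n : ℕ) : 2 ≤ dim m n := by
  unfold dim
  have : (0 : ℝ) ≤ n := Nat.cast_nonneg n
  have : (0 : ℝ) ≤ m := Nat.cast_nonneg m
  linarith

lemma dim_pos (m n : ℕ) : 0 < dim m n := by linarith [two_le_dim m n]

lemma sqrt_dim_ge (m n : ℕ) : 1.414 ≤ Real.sqrt (dim m n) :=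
  Real.le_sqrt_of_sq_le (by norm_num; linarith [two_le_dim m n])

lemma sdMatrix_skew (p q : Idx m n) : sdMatrix A b c p q = -sdMatrix A b c q p := by
  rcases p with p | p | p | p <;> rcases q with q | q | q | q <;> simp [sdMatrix]

lemma sum_mul_mulVec_comm (v v' : Idx m n → ℝ) :
    ∑ i, v i * (sdMatrix A b c).mulVec v' i = -∑ i, v' i * (sdMatrix A b c).mulVec v i := by
  simp only [Matrix.mulVec, dotProduct, Finset.mul_sum]
  rw [Finset.sum_comm, ← Finset.sum_neg_distrib]
  refine Finset.sum_congr rfl fun i _ => ?_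
  rw [← Finset.sum_neg_distrib]
  refine Finset.sum_congr rfl fun j _ => ?_
  rw [sdMatrix_skew j i]
  ring

lemma sum_mul_mulVec_self (v : Idx m n → ℝ) :
    ∑ i, v i * (sdMatrix A b c).mulVec v i = 0 := by
  linarith [sum_mul_mulVec_comm (A := A) (b := b) (c := c) v v]

lemma sum_sdRhs_mul (v : Idx m n → ℝ) :
    ∑ i, v i * sdRhs m n i = dim m n * v (iGam m n) := by
  simp [sdRhs, mul_comm]

/-- The `γ` column is chosen so that each of the first three block rows sums to 1; skewness and the
right-hand side `N` then do the same for the last row. -/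
lemma ones_satisfiesEqs : SatisfiesEqs A b c (ones m n) := by
  funext p
  rcases p with p | p | p | p <;>
    simp [slk, var, ones, Matrix.mulVec, dotProduct, sdMatrix, sdRhs, iGam, bBar, cBar, oBar, dim,
      Finset.sum_add_distrib, Finset.sum_sub_distrib, Finset.sum_neg_distrib] <;>
    linarith [Finset.sum_comm (s := Finset.univ) (t := Finset.univ) (f := fun i j => A i j)]

lemma satisfiesEqs_apply {Z : Point m n} (h : SatisfiesEqs A b c Z) (i : Idx m n) :
    slk Z i = (sdMatrix A b c).mulVec (var Z) i + sdRhs m n i := congrFun h i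

/-- The right-hand side cancels in the difference, leaving `vᵀMv` with `M` skew. -/
lemma sum_sub_mul_sub {Z Z' : Point m n} (h : SatisfiesEqs A b c Z)
    (h' : SatisfiesEqs A b c Z') :
    ∑ i, (var Z i - var Z' i) * (slk Z i - slk Z' i) = 0 := by
  rw [← sum_mul_mulVec_self (A := A) (b := b) (c := c) (var Z - var Z')]
  refine Finset.sum_congr rfl fun i _ => ?_
  rw [satisfiesEqs_apply h, satisfiesEqs_apply h', Matrix.mulVec_sub]
  simp

lemma sum_var_mul_slk {Z : Point m n} (h : SatisfiesEqs A b c Z) :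
    ∑ i, var Z i * slk Z i = dim m n * var Z (iGam m n) := by
  simp only [satisfiesEqs_apply h, mul_add, Finset.sum_add_distrib, sum_sdRhs_mul,
    sum_mul_mulVec_self, zero_add]

/-- Since `zᵀMz = 0`, only `N γ` survives in `zᵀw`. So `μ` is linear on the solutions of the
equalities, and optimality means `μ = 0`. -/
lemma mu_eq {Z : Point m n} (h : SatisfiesEqs A b c Z) : mu Z = var Z (iGam m n) := by
  rw [mu, sum_var_mul_slk h, mul_div_cancel_left₀ _ (dim_pos m n).ne']

lemma sum_var_mul_slk_eq_mu (Z : Point m n) :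
    ∑ i, var Z i * slk Z i = dim m n * mu Z := by
  rw [mu, mul_div_cancel₀ _ (dim_pos m n).ne']

/-- Orthogonality against the all-one point. On the feasible set this bounds all coordinates in
terms of `μ`. -/
lemma sum_var_add_slk {Z : Point m n} (h : SatisfiesEqs A b c Z) :
    ∑ i, var Z i + ∑ i, slk Z i = dim m n * (1 + mu Z) := by
  have h1 := sum_sub_mul_sub h (ones_satisfiesEqs (A := A) (b := b) (c := c))
  have h2 : ∀ i, (var Z i - var (ones m n) i) * (slk Z i - slk (ones m n) i) =
      var Z i * slk Z i - (var Z i + slk Z i) + 1 := fun i => by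
    simp only [var, slk, ones]; ring
  simp only [h2, Finset.sum_add_distrib, Finset.sum_sub_distrib, sum_var_mul_slk_eq_mu,
    Finset.sum_const, Finset.card_univ, nsmul_eq_mul, card_idx] at h1
  linarith

lemma mu_ones : mu (ones m n) = 1 := by
  simp only [mu, var, slk, ones, mul_one, Finset.sum_const, Finset.card_univ, nsmul_eq_mul,
    card_idx]
  exact div_self (dim_pos m n).ne'

lemma ones_mem_nbhd {θ : ℝ} (hθ : 0 ≤ θ) : ones m n ∈ nbhd A b c θ := by
  refine ⟨⟨⟨ones_satisfiesEqs, ?_, ?_⟩, ?_, ?_⟩, ?_⟩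
  iterate 4 · intro i; simp [var, slk, ones]
  rw [mu_ones]
  simpa [norm2, var, slk, ones] using hθ

lemma var_step (Z : Point m n) (lam : Idx m n → ℝ) (i : Idx m n) :
    var (Z + (calV A b c).mulVec lam) i = var Z i + -lam i := by
  simp [var, calV, Matrix.fromRows_mulVec, Matrix.neg_mulVec]

lemma slk_step (Z : Point m n) (lam : Idx m n → ℝ) (i : Idx m n) :
    slk (Z + (calV A b c).mulVec lam) i = slk Z i + -(sdMatrix A b c).mulVec lam i := by
  simp [slk, calV, Matrix.fromRows_mulVec, Matrix.neg_mulVec]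

lemma oss_mulVec (Z : Point m n) (lam : Idx m n → ℝ) (i : Idx m n) :
    (oss A b c Z).mulVec lam i =
      var Z i * -(sdMatrix A b c).mulVec lam i + slk Z i * -lam i := by
  simp [oss, calD, calV, Matrix.fromCols_mul_fromRows, Matrix.add_mulVec, Matrix.neg_mulVec,
    ← Matrix.mulVec_mulVec, Matrix.mulVec_diagonal]

lemma satisfiesEqs_step {Z : Point m n} (h : SatisfiesEqs A b c Z) (lam : Idx m n → ℝ) :
    SatisfiesEqs A b c (Z + (calV A b c).mulVec lam) := by
  have hv : var (Z + (calV A b c).mulVec lam) = var Z + -lam := funext (var_step Z lam)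
  funext i
  rw [slk_step, hv, Matrix.mulVec_add, Matrix.mulVec_neg, satisfiesEqs_apply h]
  simp only [Pi.add_apply, Pi.neg_apply]
  ring

/-- The residual is the matrix applied to the error, so the error test implies the residual test.
`div_self_le_one` also covers a zero operator norm, where division yields 0. -/
lemma residual_le_of_accepted {Z : Point m n} (hμ : 0 ≤ mu Z) {lam : Idx m n → ℝ}
    (h : Accepted A b c Z lam) :
    norm2 ((oss A b c Z).mulVec lam - calR Z) ≤ eta * mu Z := by
  rcases h with h | ⟨lamEx, hex, h⟩
  · exact h
  · rw [← hex, ← Matrix.mulVec_sub]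
    refine (norm2_mulVec_le _ _).trans ((mul_le_mul_of_nonneg_left h (norm_nonneg _)).trans ?_)
    rw [mul_div_left_comm]
    exact mul_le_of_le_one_right (mul_nonneg (by norm_num [eta]) hμ) (div_self_le_one _)

/-- The two neighbourhood sizes of the algorithm. -/
lemma step_constants {θ : ℝ} (hθ : θ = 2 / 10 ∨ θ = 3 / 10) : ∃ g : ℝ, 0 ≤ g ∧
    θ ^ 2 + (11 / 100) ^ 2 ≤ g ^ 2 ∧
    1 / 10 + (g + 1 / 10) ^ 2 / (2 * (1 - θ)) ≤ θ * (1 - 21 / 141.4) := by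
  rcases hθ with rfl | rfl
  -- Both values of `g` are `√(θ² + 0.11²)` rounded up to three decimals.
  · exact ⟨229 / 1000, by norm_num, by norm_num, by norm_num⟩
  · exact ⟨320 / 1000, by norm_num, by norm_num, by norm_num⟩

lemma mu_pos_of_mem_nbhd {θ : ℝ} {Z : Point m n} (hZ : Z ∈ nbhd A b c θ) : 0 < mu Z :=
  (mu_eq hZ.1.1.1).symm ▸ hZ.1.2.1 _

lemma step_mem_nbhd {θ : ℝ} (hθ : θ = 2 / 10 ∨ θ = 3 / 10) {Z Z' : Point m n}
    (hZ : Z ∈ nbhd A b c θ) (hstep : Step A b c Z Z') :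
    Z' ∈ nbhd A b c θ ∧ mu Z' ≤ (1 - (1 / 100) / Real.sqrt (dim m n)) * mu Z := by
  obtain ⟨lam, hacc, rfl⟩ := hstep
  obtain ⟨g, hg, hg2, hgθ⟩ := step_constants hθ
  have hμ := mu_pos_of_mem_nbhd hZ
  have hr := residual_le_of_accepted hμ.le hacc
  have heqs := satisfiesEqs_step hZ.1.1.1 lam
  obtain ⟨μ', hsum, -, hle, hnb, hzpos, hwpos⟩ := inexact_step (ι := Idx m n) (z := var Z)
    (w := slk Z) (dz := fun i => -lam i) (dw := fun i => -(sdMatrix A b c).mulVec lam i)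
    (μ := mu Z) (θ := θ) (g := g) (s := Real.sqrt (dim m n))
    (by rw [Real.sq_sqrt (dim_pos m n).le, card_idx]) (sqrt_dim_ge m n) hμ
    (by rcases hθ with rfl | rfl <;> norm_num) (by rcases hθ with rfl | rfl <;> norm_num)
    hg hg2 hgθ hZ.1.2.1 hZ.1.2.2 (by rw [card_idx, sum_var_mul_slk_eq_mu]) hZ.2
    (by simpa using sum_mul_mulVec_self lam)
    (by
      refine le_of_eq_of_le (congrArg norm2 (funext fun i => ?_)) hr
      simp only [Pi.sub_apply, oss_mulVec, calR, beta])
  simp only [← var_step (A := A) (b := b) (c := c), ← slk_step] at hsum hnb hzpos hwpos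
  have hμ' : mu (Z + (calV A b c).mulVec lam) = μ' := by
    rw [mu, hsum, card_idx, mul_div_cancel_left₀ _ (dim_pos m n).ne']
  rw [← hμ'] at hle hnb
  exact ⟨⟨⟨⟨heqs, fun i => (hzpos i).le, fun i => (hwpos i).le⟩, hzpos, hwpos⟩, hnb⟩, hle⟩

/-- The system is nonsingular: multiplying row `i` of a kernel relation by `lam_i / z_i` and summing
cancels the skew term and leaves `∑ (w_i / z_i) lam_i² = 0`. -/
lemma exists_step {Z : Point m n} (hZ : Z ∈ interiorFeasible A b c) :
    ∃ Z', Step A b c Z Z' := by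
  have hinj : Function.Injective (Matrix.mulVecLin (oss A b c Z)) := by
    rw [← LinearMap.ker_eq_bot, LinearMap.ker_eq_bot']
    intro lam h
    have h0 : ∀ i, var Z i * (sdMatrix A b c).mulVec lam i + slk Z i * lam i = 0 := fun i => by
      have := congrFun h i
      rw [Matrix.mulVecLin_apply, oss_mulVec] at this
      simp only [Pi.zero_apply] at this
      linarith
    have h1 : ∑ i, slk Z i / var Z i * lam i ^ 2 = 0 := by
      have h2 := sum_mul_mulVec_self (A := A) (b := b) (c := c) lam
      rw [← neg_eq_zero, ← Finset.sum_neg_distrib] at h2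
      rw [← h2]
      refine Finset.sum_congr rfl fun i _ => ?_
      have := (hZ.2.1 i).ne'
      field_simp
      linear_combination lam i * h0 i
    have hp : ∀ i, 0 < slk Z i / var Z i := fun i => div_pos (hZ.2.2 i) (hZ.2.1 i)
    rw [Finset.sum_eq_zero_iff_of_nonneg fun i _ => mul_nonneg (hp i).le (sq_nonneg _)] at h1
    funext i
    simpa [(hp i).ne'] using h1 i (Finset.mem_univ i)
  obtain ⟨lam, hlam⟩ := LinearMap.surjective_of_injective hinj (calR Z)
  refine ⟨_, lam, Or.inl ?_, rfl⟩
  rw [Matrix.mulVecLin_apply] at hlam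
  rw [hlam, sub_self]
  have : 0 ≤ mu Z := (mu_eq hZ.1.1).symm ▸ (hZ.2.1 _).le
  simpa [norm2, eta] using this

/-! ### Linear convergence and iteration counts. -/

section Run

variable {θ : ℝ} {X : ℕ → Point m n}

lemma run_mem_nbhd (hθ : θ = 2 / 10 ∨ θ = 3 / 10) (hX : IsRun A b c θ X) (k : ℕ) :
    X k ∈ nbhd A b c θ := by
  induction k with
  | zero => exact hX.1
  | succ k ih => exact (step_mem_nbhd hθ ih (hX.2 k)).1

lemma run_mu_succ_le (hθ : θ = 2 / 10 ∨ θ = 3 / 10) (hX : IsRun A b c θ X) (k : ℕ) :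
    mu (X (k + 1)) ≤ (1 - (1 / 100) / Real.sqrt (dim m n)) * mu (X k) :=
  (step_mem_nbhd hθ (run_mem_nbhd hθ hX k) (hX.2 k)).2

lemma rate_mem (m n : ℕ) : 0 ≤ 1 - (1 / 100) / Real.sqrt (dim m n) ∧
    1 - (1 / 100) / Real.sqrt (dim m n) < 1 := by
  have h := sqrt_dim_ge m n
  have h1 : (1 / 100) / Real.sqrt (dim m n) ≤ 1 := by
    rw [div_le_one (by linarith)]; linarith
  have h2 : 0 < (1 / 100) / Real.sqrt (dim m n) := div_pos (by norm_num) (by linarith)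
  constructor <;> linarith

lemma run_mu_le_pow (hθ : θ = 2 / 10 ∨ θ = 3 / 10) (hX : IsRun A b c θ X) (k : ℕ) :
    mu (X k) ≤ (1 - (1 / 100) / Real.sqrt (dim m n)) ^ k * mu (X 0) := by
  induction k with
  | zero => simp
  | succ k ih =>
    refine (run_mu_succ_le hθ hX k).trans ?_
    rw [pow_succ', mul_assoc]
    exact mul_le_mul_of_nonneg_left ih (rate_mem m n).1

lemma run_mu_tendsto (hθ : θ = 2 / 10 ∨ θ = 3 / 10) (hX : IsRun A b c θ X) :
    Tendsto (fun k => mu (X k)) atTop (𝓝 0) := by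
  have h := (tendsto_pow_atTop_nhds_zero_of_lt_one (rate_mem m n).1
    (rate_mem m n).2).mul_const (mu (X 0))
  rw [zero_mul] at h
  exact squeeze_zero (fun k => (mu_pos_of_mem_nbhd (run_mem_nbhd hθ hX k)).le)
    (run_mu_le_pow hθ hX) h

/-- After `100 √N t` iterations `μ` has shrunk by the factor `exp (-t)`. -/
lemma run_mu_le_exp (hθ : θ = 2 / 10 ∨ θ = 3 / 10) (hX : IsRun A b c θ X) {k : ℕ} {t : ℝ}
    (hk : 100 * Real.sqrt (dim m n) * t ≤ k) : mu (X k) ≤ Real.exp (-t) * mu (X 0) := by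
  have hs : 0 < Real.sqrt (dim m n) := Real.sqrt_pos.2 (dim_pos m n)
  refine (run_mu_le_pow hθ hX k).trans (mul_le_mul_of_nonneg_right ?_
    (mu_pos_of_mem_nbhd hX.1).le)
  calc (1 - (1 / 100) / Real.sqrt (dim m n)) ^ k
      ≤ Real.exp (-((1 / 100) / Real.sqrt (dim m n))) ^ k :=
        pow_le_pow_left₀ (rate_mem m n).1 (Real.one_sub_le_exp_neg _) k
    _ = Real.exp (-(k * ((1 / 100) / Real.sqrt (dim m n)))) := by
        rw [← Real.exp_nat_mul]; congr 1; ring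
    _ ≤ Real.exp (-t) := by
        refine Real.exp_le_exp.2 (neg_le_neg ?_)
        rw [← mul_div_assoc, le_div_iff₀ hs]
        linarith

lemma run_mu_le_start (hθ : θ = 2 / 10 ∨ θ = 3 / 10) (hX : IsRun A b c θ X) (k : ℕ) :
    mu (X k) ≤ mu (X 0) := by
  simpa using run_mu_le_exp hθ hX (k := k) (t := 0) (by simp)

lemma run_mu_le_of_log_le (hθ : θ = 2 / 10 ∨ θ = 3 / 10) (hX : IsRun A b c θ X) {k : ℕ}
    {μ₀ ζ : ℝ} (hζ : 0 < ζ) (hμ₀ : mu (X 0) ≤ μ₀)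
    (hk : 100 * Real.sqrt (dim m n) * Real.log (μ₀ / ζ) ≤ k) : mu (X k) ≤ ζ := by
  have h0 : 0 < μ₀ := (mu_pos_of_mem_nbhd hX.1).trans_le hμ₀
  refine (run_mu_le_exp hθ hX hk).trans ?_
  rw [Real.exp_neg, Real.exp_log (div_pos h0 hζ), inv_div, div_mul_eq_mul_div, div_le_iff₀ h0]
  exact mul_le_mul_of_nonneg_left hμ₀ hζ.le

end Run

lemma sqrt_dim_le {κ : ℝ} (hκ : (n : ℝ) + m + 2 ≤ κ * n) :
    0 < n ∧ Real.sqrt (dim m n) ≤ Real.sqrt κ * Real.sqrt n := by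
  have hn : 0 < n := by
    rcases Nat.eq_zero_or_pos n with rfl | h
    · have : (0 : ℝ) ≤ m := Nat.cast_nonneg m
      simp at hκ; linarith
    · exact h
  refine ⟨hn, ?_⟩
  rw [← Real.sqrt_mul' _ (Nat.cast_nonneg n)]
  exact Real.sqrt_le_sqrt hκ

end Embedding

/-! ### Cramer bounds for solutions of integral linear systems. -/

section Cramer

/-- Expanding the product of row sums gives one nonnegative term for each map `J → J`; the Leibniz
formula uses only the bijections. -/
lemma abs_det_le_prod_sum_abs {J : Type*} [Fintype J] [DecidableEq J] (B : Matrix J J ℝ) :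
    |B.det| ≤ ∏ i, ∑ j, |B i j| := by
  rw [Finset.prod_univ_sum, ← Matrix.det_transpose, Matrix.det_apply]
  calc |∑ σ : Equiv.Perm J, Equiv.Perm.sign σ • ∏ i, B.transpose (σ i) i|
      ≤ ∑ σ : Equiv.Perm J, ∏ i, |B i (σ i)| := by
        refine (Finset.abs_sum_le_sum_abs _ _).trans (Finset.sum_le_sum fun σ _ => ?_)
        rw [Units.smul_def, zsmul_eq_mul, abs_mul, Finset.abs_prod]
        simp only [Matrix.transpose_apply]
        rcases Int.units_eq_one_or (Equiv.Perm.sign σ) with h | h <;> simp [h]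
    _ = ∑ x ∈ Finset.univ.image (fun σ : Equiv.Perm J => (σ : J → J)), ∏ i, |B i (x i)| := by
        rw [Finset.sum_image fun σ _ τ _ h => Equiv.ext (congrFun h)]
    _ ≤ _ := Finset.sum_le_sum_of_subset_of_nonneg (by intro x _; simp)
        fun _ _ _ => Finset.prod_nonneg fun _ _ => abs_nonneg _

variable {R C : Type*} [Fintype C]

/-- Linearly independent columns contain a nonsingular square submatrix. -/
lemma exists_submatrix_det_ne_zero [Fintype R] {J : Type*} [Fintype J] [DecidableEq J] (G : Matrix R J ℝ)
    (hG : LinearIndependent ℝ G.col) :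
    ∃ f : J → R, Function.Injective f ∧ (G.submatrix f id).det ≠ 0 := by
  obtain ⟨κ, a, ha, hspan, hli⟩ := exists_linearIndependent' ℝ G.row
  have : Fintype κ := Fintype.ofInjective a ha
  have hcard : Fintype.card κ = Fintype.card J := by
    rw [← finrank_span_eq_card hli, hspan, ← Matrix.rank_eq_finrank_span_row,
      Matrix.rank_eq_finrank_span_cols, finrank_span_eq_card hG]
  let e : J ≃ κ := (Fintype.equivOfCardEq hcard).symm
  refine ⟨a ∘ e, ha.comp e.injective, ?_⟩
  have hrow : LinearIndependent ℝ (G.submatrix (a ∘ e) id).row := hli.comp e e.injective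
  rw [Matrix.linearIndependent_rows_iff_isUnit, Matrix.isUnit_iff_isUnit_det] at hrow
  exact hrow.ne_zero

lemma mul_det_eq_det_updateCol {J : Type*} [Fintype J] [DecidableEq J] (B : Matrix J J ℝ)
    (y : J → ℝ) (j : J) : B.det * y j = (B.updateCol j (B.mulVec y)).det := by
  rw [← Matrix.cramer_apply, Matrix.cramer_eq_adjugate_mulVec, Matrix.mulVec_mulVec,
    Matrix.adjugate_mul, Matrix.smul_mulVec, Matrix.one_mulVec]
  rfl

lemma one_le_abs_det {J : Type*} [Fintype J] [DecidableEq J] {B : Matrix J J ℝ}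
    {Bi : Matrix J J ℤ} (hB : B = Bi.map (fun t : ℤ => (t : ℝ))) (h : B.det ≠ 0) : 1 ≤ |B.det| := by
  have hdet : B.det = (Bi.det : ℝ) := by
    rw [hB]
    exact ((Int.castRingHom ℝ).map_det Bi).symm
  rw [hdet] at h ⊢
  exact_mod_cast Int.one_le_abs (by exact_mod_cast h)

lemma prod_comp_le_prod [Fintype R] {J : Type*} [Fintype J] {f : J → R} (hf : Function.Injective f)
    {ρ : R → ℝ} (hρ : ∀ r, 1 ≤ ρ r) : ∏ j, ρ (f j) ≤ ∏ r, ρ r := by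
  classical
  rw [← Finset.prod_image (s := Finset.univ) (f := ρ) (g := f) hf.injOn]
  exact Finset.prod_le_prod_of_subset_of_one_le (Finset.subset_univ _)
    (fun i _ => zero_le_one.trans (hρ i)) fun i _ _ => hρ i

variable {G : Matrix R C ℝ} {ρ : R → ℝ}

lemma one_le_of_row_bound (hρ : ∀ r, ∑ c, |G r c| + 1 ≤ ρ r) (r : R) : 1 ≤ ρ r :=
  le_trans (le_add_of_nonneg_left (Finset.sum_nonneg fun _ _ => abs_nonneg _)) (hρ r)

lemma sum_abs_comp_le {J : Type*} [Fintype J] {a : J → C} (ha : Function.Injective a) (r : R) :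
    ∑ j, |G r (a j)| ≤ ∑ c, |G r c| := by
  classical
  rw [← Finset.sum_image (s := Finset.univ) (f := fun c => |G r c|) (g := a) ha.injOn]
  exact Finset.sum_le_sum_of_subset_of_nonneg (Finset.subset_univ _)
    fun _ _ _ => abs_nonneg _

variable [Fintype R]

lemma abs_det_submatrix_le (hρ : ∀ r, ∑ c, |G r c| + 1 ≤ ρ r) {J : Type*} [Fintype J]
    [DecidableEq J] {f : J → R} {a : J → C} (hf : Function.Injective f)
    (ha : Function.Injective a) : |(G.submatrix f a).det| ≤ ∏ r, ρ r := by
  refine (abs_det_le_prod_sum_abs _).trans ((Finset.prod_le_prod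
    (fun i _ => Finset.sum_nonneg fun _ _ => abs_nonneg _) fun i _ => ?_).trans
    (prod_comp_le_prod hf (one_le_of_row_bound hρ)))
  have h := sum_abs_comp_le (G := G) ha (f i)
  simp only [Matrix.submatrix_apply]
  linarith [hρ (f i)]

/-- The spare unit in the row bound pays for the replaced column, whose entries are at most 1 in
absolute value. -/
lemma abs_det_updateCol_submatrix_le (hρ : ∀ r, ∑ c, |G r c| + 1 ≤ ρ r) {J : Type*} [Fintype J]
    [DecidableEq J] {f : J → R} {a : J → C} (hf : Function.Injective f)
    (ha : Function.Injective a) (j : J) {h : J → ℝ} (hh : ∀ i, |h i| ≤ 1) :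
    |((G.submatrix f a).updateCol j h).det| ≤ ∏ r, ρ r := by
  refine (abs_det_le_prod_sum_abs _).trans ((Finset.prod_le_prod
    (fun i _ => Finset.sum_nonneg fun _ _ => abs_nonneg _) fun i _ => ?_).trans
    (prod_comp_le_prod hf (one_le_of_row_bound hρ)))
  have h1 := sum_abs_comp_le (G := G) ha (f i)
  have h2 : ∑ k, |(G.submatrix f a).updateCol j h i k| ≤
      ∑ k, (|G (f i) (a k)| + if k = j then 1 else 0) := by
    refine Finset.sum_le_sum fun k _ => ?_
    rw [Matrix.updateCol_apply]
    split_ifs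
    · linarith [hh i, abs_nonneg (G (f i) (a k))]
    · simp
  rw [Finset.sum_add_distrib] at h2
  simp only [Finset.sum_ite_eq', Finset.mem_univ, if_true] at h2
  linarith [hρ (f i)]

/-- A solvable integral linear system has a solution that is small if the right-hand side is,
using only prescribed columns. -/
lemma exists_small_solution {Gi : Matrix R C ℤ} (hGi : G = Gi.map (fun t : ℤ => (t : ℝ)))
    (hρ : ∀ r, ∑ c, |G r c| + 1 ≤ ρ r) {S : Set C} {x : C → ℝ} (hx : ∀ c ∉ S, x c = 0)
    {ε : ℝ} (hε : 0 < ε) (hsmall : ∀ r, |G.mulVec x r| ≤ ε) :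
    ∃ d : C → ℝ, (∀ c ∉ S, d c = 0) ∧ G.mulVec d = G.mulVec x ∧
      ∀ c, |d c| ≤ (∏ r, ρ r) * ε := by
  classical
  -- A maximal independent family of the columns in `S` spans them all, so `G x` is reproduced by
  -- these columns alone, with coefficients determined by a nonsingular minor.
  obtain ⟨κ, a₀, ha₀, hspan, hli⟩ := exists_linearIndependent' ℝ (fun c : S => G.col c)
  have : Fintype κ := Fintype.ofInjective a₀ ha₀
  set a : κ → C := fun j => (a₀ j : C)
  have ha : Function.Injective a := Subtype.val_injective.comp ha₀
  have hmem : G.mulVec x ∈ Submodule.span ℝ (Set.range ((fun c : S => G.col c) ∘ a₀)) := by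
    have hcol : G.mulVec x = ∑ c, x c • G.col c := by
      funext r
      simp [Matrix.mulVec, dotProduct, mul_comm]
    rw [hspan, hcol]
    refine Submodule.sum_mem _ fun c _ => ?_
    by_cases hc : c ∈ S
    · exact Submodule.smul_mem _ _ (Submodule.subset_span (Set.mem_range_self (⟨c, hc⟩ : S)))
    · simp [hx c hc]
  obtain ⟨y, hy⟩ := (Submodule.mem_span_range_iff_exists_fun ℝ).1 hmem
  have hyr : ∀ r, ∑ j, G r (a j) * y j = G.mulVec x r := fun r => by
    rw [← hy, Finset.sum_apply]
    exact Finset.sum_congr rfl fun j _ => mul_comm _ _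
  obtain ⟨f, hf, hdet⟩ := exists_submatrix_det_ne_zero (G.submatrix id a) hli
  set B : Matrix κ κ ℝ := G.submatrix f a
  have hBdet : B.det ≠ 0 := hdet
  have hB1 : 1 ≤ |B.det| := one_le_abs_det (Bi := Gi.submatrix f a) (by rw [← Matrix.submatrix_map, ← hGi]) hBdet
  -- With `ε` pulled out, the column put in by Cramer's rule has entries of modulus at most 1.
  have hBy : B.mulVec y = ε • fun i => G.mulVec x (f i) / ε := by
    funext i
    simp only [Pi.smul_apply, smul_eq_mul]
    rw [mul_div_cancel₀ _ hε.ne', ← hyr]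
    rfl
  have hyle : ∀ j, |y j| ≤ (∏ r, ρ r) * ε := fun j => by
    have h1 := mul_det_eq_det_updateCol B y j
    rw [hBy, Matrix.det_updateCol_smul] at h1
    have h2 : |((B).updateCol j fun i => G.mulVec x (f i) / ε).det| ≤ ∏ r, ρ r :=
      abs_det_updateCol_submatrix_le hρ hf ha j fun i => by
        rw [abs_div, abs_of_pos hε, div_le_one hε]
        exact hsmall _
    calc |y j| ≤ |B.det| * |y j| := le_mul_of_one_le_left (abs_nonneg _) hB1
      _ = ε * |((B).updateCol j fun i => G.mulVec x (f i) / ε).det| := by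
        rw [← abs_mul, h1, abs_mul, abs_of_pos hε]
      _ ≤ ε * ∏ r, ρ r := mul_le_mul_of_nonneg_left h2 hε.le
      _ = _ := mul_comm _ _
  have hρ0 : 0 ≤ (∏ r, ρ r) * ε := mul_nonneg
    (Finset.prod_nonneg fun r _ => zero_le_one.trans (one_le_of_row_bound hρ r)) hε.le
  refine ⟨Function.extend a y 0, fun c hc => ?_, ?_, fun c => ?_⟩
  · refine Function.extend_apply' _ _ _ ?_
    rintro ⟨j, rfl⟩
    exact hc (a₀ j).2
  · funext r
    rw [← hyr]
    refine (Fintype.sum_of_injective a ha _ _ (fun c hc => ?_) fun j => ?_).symm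
    · rw [Function.extend_apply' _ _ _ hc]; simp
    · rw [ha.extend_apply]
  · by_cases hc : ∃ j, a j = c
    · obtain ⟨j, rfl⟩ := hc
      rw [ha.extend_apply]
      exact hyle j
    · rw [Function.extend_apply' _ _ _ hc]
      simpa using hρ0

/-- An integral system `G x = q`, `x ≥ 0` without recession directions has, for each coordinate
that is positive in some solution, a solution in which this coordinate is not small. -/
lemma exists_solution_coord_ge {Gi : Matrix R C ℤ} (hGi : G = Gi.map (fun t : ℤ => (t : ℝ)))
    (hρ : ∀ r, ∑ c, |G r c| + 1 ≤ ρ r) {q : R → ℝ} {qi : R → ℤ} (hqi : ∀ r, q r = qi r)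
    {S : Set C}
    (hrec : ∀ v : C → ℝ, (∀ c ∉ S, v c = 0) → (∀ c, 0 ≤ v c) → G.mulVec v = 0 → v = 0)
    {x : C → ℝ} (hx : G.mulVec x = q) (hx0 : ∀ c, 0 ≤ x c) (hxS : ∀ c ∉ S, x c = 0)
    {c₀ : C} (hc₀ : 0 < x c₀) :
    ∃ x' : C → ℝ, G.mulVec x' = q ∧ (∀ c, 0 ≤ x' c) ∧ (∀ c ∉ S, x' c = 0) ∧
      1 / ∏ r, ρ r ≤ x' c₀ := by
  classical
  -- Purification to a basic solution. If the support columns are independent, Cramer's rule writes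
  -- `x c₀` as a nonzero integer over a bounded minor; otherwise the support can be shrunk while
  -- keeping `x c₀ > 0`.
  induction hk : (Finset.univ.filter fun c => x c ≠ 0).card using Nat.strong_induction_on
    generalizing x with
  | _ k ih =>
  let J := {c : C // x c ≠ 0}
  by_cases hli : LinearIndependent ℝ (G.submatrix id (Subtype.val : J → C)).col
  · refine ⟨x, hx, hx0, hxS, ?_⟩
    obtain ⟨f, hf, hdet⟩ := exists_submatrix_det_ne_zero _ hli
    set B : Matrix J J ℝ := G.submatrix f Subtype.val
    have hBdet : B.det ≠ 0 := hdet
    have hBle : |B.det| ≤ ∏ r, ρ r := abs_det_submatrix_le hρ hf Subtype.val_injective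
    let j₀ : J := ⟨c₀, hc₀.ne'⟩
    have hBy : B.mulVec (fun j => x j) = fun i => q (f i) := by
      funext i
      rw [← hx]
      refine Fintype.sum_of_injective Subtype.val Subtype.val_injective _ _ (fun c hc => ?_)
        fun j => rfl
      have : x c = 0 := by
        by_contra h
        exact hc ⟨⟨c, h⟩, rfl⟩
      simp [this]
    have h1 := mul_det_eq_det_updateCol B (fun j => x j) j₀
    rw [hBy] at h1
    have h2 : 1 ≤ |(B.updateCol j₀ fun i => q (f i)).det| := by
      refine one_le_abs_det (Bi := (Gi.submatrix f Subtype.val).updateCol j₀ fun i => qi (f i))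
        ?_ ?_
      · ext i j
        simp only [Matrix.updateCol_apply, Matrix.map_apply, B, Matrix.submatrix_apply, hqi, hGi]
        split_ifs <;> rfl
      · rw [← h1]
        exact mul_ne_zero hBdet hc₀.ne'
    rw [← h1, abs_mul, abs_of_pos hc₀] at h2
    rw [div_le_iff₀ ((abs_pos.2 hBdet).trans_le hBle)]
    calc 1 ≤ _ := h2
      _ ≤ (∏ r, ρ r) * x c₀ := mul_le_mul_of_nonneg_right hBle hc₀.le
      _ = _ := mul_comm _ _
  · obtain ⟨g, hg, j, hj⟩ := Fintype.not_linearIndependent_iff.1 hli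
    -- a kernel vector supported on the support of `x`
    obtain ⟨v, hv0, hvx, hGv⟩ : ∃ v : C → ℝ, v ≠ 0 ∧ (∀ c, x c = 0 → v c = 0) ∧
        G.mulVec v = 0 := by
      refine ⟨Function.extend Subtype.val g 0, fun h => hj ?_, fun c hc => ?_, ?_⟩
      · rw [← Subtype.val_injective.extend_apply g 0 j, h]; rfl
      · refine Function.extend_apply' _ _ _ ?_
        rintro ⟨⟨_, h⟩, rfl⟩
        exact h hc
      · funext r
        have := congrFun hg r
        rw [Finset.sum_apply] at this
        rw [← this]
        refine (Fintype.sum_of_injective Subtype.val Subtype.val_injective _ _ (fun c hc => ?_)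
          fun j => ?_).symm
        · rw [Function.extend_apply' _ _ _ hc]; simp
        · rw [Subtype.val_injective.extend_apply]; exact mul_comm _ _
    -- Orient `v` so that moving along it never decreases the coordinate `c₀`.
    wlog hvc : 0 ≤ v c₀ generalizing v
    · exact this (-v) (neg_ne_zero.2 hv0) (fun c hc => by simp [hvx c hc])
        (by rw [Matrix.mulVec_neg, hGv, neg_zero]) (by simp only [Pi.neg_apply]; linarith)
    have hneg : (Finset.univ.filter fun c => v c < 0).Nonempty := by
      by_contra h
      rw [Finset.not_nonempty_iff_eq_empty, Finset.filter_eq_empty_iff] at h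
      exact hv0 (hrec v (fun c hc => hvx c (hxS c hc))
        (fun c => not_lt.1 (h (Finset.mem_univ c))) hGv)
    -- Ratio test: the longest step that preserves nonnegativity makes `c₁` vanish.
    obtain ⟨c₁, hc₁, hmin⟩ := Finset.exists_min_image _ (fun c => x c / -v c) hneg
    simp only [Finset.mem_filter, Finset.mem_univ, true_and] at hc₁ hmin
    set t := x c₁ / -v c₁
    have ht : 0 ≤ t := div_nonneg (hx0 _) (by linarith)
    have hxc₁ : x c₁ ≠ 0 := fun h => hc₁.ne (hvx _ h)
    refine ih _ ?_ (x := x + t • v) ?_ (fun c => ?_) (fun c hc => ?_) ?_ rfl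
    · rw [← hk]
      refine Finset.card_lt_card ((Finset.ssubset_iff_of_subset fun c hc => ?_).2 ⟨c₁, ?_, ?_⟩)
      · simp only [Finset.mem_filter, Finset.mem_univ, true_and, Pi.add_apply, Pi.smul_apply,
          smul_eq_mul] at hc ⊢
        intro h
        exact hc (by rw [h, hvx c h]; simp)
      · simpa using hxc₁
      · have : -v c₁ ≠ 0 := by linarith
        simp only [Finset.mem_filter, Finset.mem_univ, true_and, Pi.add_apply, Pi.smul_apply,
          smul_eq_mul, not_not]
        linear_combination -(div_mul_cancel₀ (x c₁) this)
    · rw [Matrix.mulVec_add, Matrix.mulVec_smul, hGv, hx]; simp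
    · simp only [Pi.add_apply, Pi.smul_apply, smul_eq_mul]
      rcases lt_or_ge (v c) 0 with h | h
      · have := hmin c h
        rw [le_div_iff₀ (by linarith)] at this
        linarith
      · exact add_nonneg (hx0 c) (mul_nonneg ht h)
    · simp [hxS c hc, hvx c (hxS c hc)]
    · simp only [Pi.add_apply, Pi.smul_apply, smul_eq_mul]
      exact add_pos_of_pos_of_nonneg hc₀ (mul_nonneg ht hvc)

end Cramer

/-! ### Existence and uniqueness of Euclidean projections. -/

section Nearest

variable {ι : Type} [Fintype ι]

lemma exists_nearest {F : Set (ι → ℝ)} (hF : IsClosed F) (hne : F.Nonempty) (x : ι → ℝ) :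
    ∃ p ∈ F, ∀ q ∈ F, norm2 (p - x) ≤ norm2 (q - x) := by
  have hcl : IsClosed ((WithLp.ofLp : EuclideanSpace ℝ ι → ι → ℝ) ⁻¹' F) :=
    hF.preimage (PiLp.continuous_ofLp 2 _)
  obtain ⟨p₀, hp₀⟩ := hne
  obtain ⟨p, hp, hdist⟩ := hcl.exists_infDist_eq_dist ⟨WithLp.toLp 2 p₀, hp₀⟩ (WithLp.toLp 2 x)
  refine ⟨p.ofLp, hp, fun q hq => ?_⟩
  have h := Metric.infDist_le_dist_of_mem (x := WithLp.toLp 2 x)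
    (show WithLp.toLp 2 q ∈ (WithLp.ofLp : EuclideanSpace ℝ ι → ι → ℝ) ⁻¹' F from hq)
  rw [hdist, dist_comm, dist_comm _ (WithLp.toLp 2 q), dist_eq_norm, dist_eq_norm] at h
  rw [norm2_eq_norm, norm2_eq_norm, WithLp.toLp_sub, WithLp.toLp_sub]
  exact h

/-- By the parallelogram identity, the midpoint of two distinct nearest points would be strictly
nearer. -/
lemma nearest_unique {F : Set (ι → ℝ)}
    (hmid : ∀ p ∈ F, ∀ q ∈ F, (fun i => (p i + q i) / 2) ∈ F) {x p p' : ι → ℝ}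
    (hp : p ∈ F) (hp' : p' ∈ F) (h : ∀ q ∈ F, norm2 (p - x) ≤ norm2 (q - x))
    (h' : ∀ q ∈ F, norm2 (p' - x) ≤ norm2 (q - x)) : p' = p := by
  have hsq : ∀ v v' : ι → ℝ, norm2 v ≤ norm2 v' → ∑ i, v i ^ 2 ≤ ∑ i, v' i ^ 2 :=
    fun v v' hv => by
      rw [← norm2_sq, ← norm2_sq]
      exact pow_le_pow_left₀ (norm2_nonneg _) hv 2
  have h1 := hsq _ _ (h _ (hmid p hp p' hp'))
  have h2 := hsq _ _ (h' _ (hmid p hp p' hp'))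
  have h3 : ∑ i, (p' i - p i) ^ 2 =
      2 * ∑ i, (p - x) i ^ 2 + 2 * ∑ i, (p' - x) i ^ 2
        - 4 * ∑ i, ((fun i => (p i + p' i) / 2) - x) i ^ 2 := by
    simp only [Finset.mul_sum, ← Finset.sum_add_distrib, ← Finset.sum_sub_distrib, Pi.sub_apply]
    exact Finset.sum_congr rfl fun i _ => by ring
  have h4 : ∑ i, (p' i - p i) ^ 2 = 0 :=
    le_antisymm (by linarith) (Finset.sum_nonneg fun _ _ => sq_nonneg _)
  rw [Finset.sum_eq_zero_iff_of_nonneg fun _ _ => sq_nonneg _] at h4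
  funext i
  exact sub_eq_zero.1 (pow_eq_zero_iff two_ne_zero |>.1 (h4 i (Finset.mem_univ i)))

end Nearest

/-! ### Limit points are strictly complementary. -/

section Embedding

variable {m n : ℕ} {A : Matrix (Fin m) (Fin n) ℝ} {b : Fin m → ℝ} {c : Fin n → ℝ} {θ : ℝ}

lemma isClosed_satisfiesEqs : IsClosed {Z : Point m n | SatisfiesEqs A b c Z} := by
  refine isClosed_eq ?_ ?_
  · exact continuous_pi fun i => continuous_apply _
  · refine Continuous.add ?_ continuous_const
    exact Continuous.matrix_mulVec continuous_const (continuous_pi fun i => continuous_apply _)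

/-- Expansion of the orthogonality relation when `Z'` has zero gap. For feasible points all terms
are nonnegative, so each is at most `N μ`. -/
lemma sum_cross {Z Z' : Point m n} (h : SatisfiesEqs A b c Z) (h' : SatisfiesEqs A b c Z')
    (hμ : mu Z' = 0) :
    ∑ i, (var Z' i * slk Z i + slk Z' i * var Z i) = dim m n * mu Z := by
  have h1 := sum_sub_mul_sub h h'
  have h2 : ∀ i, (var Z i - var Z' i) * (slk Z i - slk Z' i) =
      var Z i * slk Z i + var Z' i * slk Z' i - (var Z' i * slk Z i + slk Z' i * var Z i) :=
    fun i => by ring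
  simp only [h2] at h1
  rw [Finset.sum_sub_distrib, Finset.sum_add_distrib, sum_var_mul_slk_eq_mu,
    sum_var_mul_slk_eq_mu, hμ] at h1
  linarith

/-- The products `z_i w_i / μ` in the neighbourhood. -/
lemma ratio_bounds {Z : Point m n} (hZ : Z ∈ nbhd A b c θ) (i : Idx m n) :
    (1 - θ) * mu Z ≤ var Z i * slk Z i ∧ var Z i * slk Z i ≤ (1 + θ) * mu Z := by
  have := (abs_le_norm2 (fun i => var Z i * slk Z i - mu Z) i).trans hZ.2
  rw [abs_le] at this
  constructor <;> linarith [this.1, this.2]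

lemma coord_le {Z : Point m n} (hZ : Z ∈ feasible A b c) (p : Idx m n ⊕ Idx m n) :
    0 ≤ Z p ∧ Z p ≤ dim m n * (1 + mu Z) := by
  have h := sum_var_add_slk hZ.1
  have hv := Finset.sum_nonneg fun i (_ : i ∈ Finset.univ) => hZ.2.1 i
  have hs := Finset.sum_nonneg fun i (_ : i ∈ Finset.univ) => hZ.2.2 i
  rcases p with i | i
  · refine ⟨hZ.2.2 i, ?_⟩
    have := Finset.single_le_sum (f := slk Z) (fun i _ => hZ.2.2 i) (Finset.mem_univ i)
    simp only [slk] at this h hs ⊢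
    linarith
  · refine ⟨hZ.2.1 i, ?_⟩
    have := Finset.single_le_sum (f := var Z) (fun i _ => hZ.2.1 i) (Finset.mem_univ i)
    simp only [var] at this h hv ⊢
    linarith

/-- Along a sequence in the neighbourhood with `μ → 0` there is a limit point, and it is a strictly
complementary solution. -/
lemma exists_strictly_complementary (hθ : θ < 1) {X : ℕ → Point m n}
    (hX : ∀ k, X k ∈ nbhd A b c θ) (hμ : Tendsto (fun k => mu (X k)) atTop (𝓝 0)) {μ₀ : ℝ}
    (hμ₀ : ∀ k, mu (X k) ≤ μ₀) :
    ∃ Z : Point m n, Z ∈ feasible A b c ∧ mu Z = 0 ∧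
      ∀ i, var Z i * slk Z i = 0 ∧ 0 < var Z i + slk Z i := by
  have hμpos := fun k => mu_pos_of_mem_nbhd (hX k)
  -- Centrality confines these ratios to `[1 - θ, 1 + θ]`, so iterates and ratios converge together
  -- along a subsequence, and the limit ratios are positive.
  set r : ℕ → Idx m n → ℝ := fun k i => var (X k) i * slk (X k) i / mu (X k) with hr
  have hrb : ∀ k i, 1 - θ ≤ r k i ∧ r k i ≤ 1 + θ := fun k i =>
    ⟨(le_div_iff₀ (hμpos k)).2 (ratio_bounds (hX k) i).1,
      (div_le_iff₀ (hμpos k)).2 (ratio_bounds (hX k) i).2⟩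
  have hdim := (dim_pos m n).le
  obtain ⟨⟨Z, r'⟩, -, φ, hφ, hlim⟩ := IsCompact.tendsto_subseq
    (s := Set.Icc (0 : Point m n) (fun _ => dim m n * (1 + μ₀)) ×ˢ
      Set.Icc (fun _ : Idx m n => 1 - θ) (fun _ => 1 + θ))
    (isCompact_Icc.prod isCompact_Icc) (x := fun k => (X k, r k))
    (fun k => ⟨⟨fun p => (coord_le (hX k).1.1 p).1, fun p => (coord_le (hX k).1.1 p).2.trans
      (mul_le_mul_of_nonneg_left (by linarith [hμ₀ k]) hdim)⟩,
      fun i => (hrb k i).1, fun i => (hrb k i).2⟩)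
  have hZlim : Tendsto (fun k => X (φ k)) atTop (𝓝 Z) := (Prod.tendsto_iff _ _).1 hlim |>.1
  have hrlim : Tendsto (fun k => r (φ k)) atTop (𝓝 r') := (Prod.tendsto_iff _ _).1 hlim |>.2
  have hμφ : Tendsto (fun k => mu (X (φ k))) atTop (𝓝 0) := hμ.comp hφ.tendsto_atTop
  have hv : ∀ i, Tendsto (fun k => var (X (φ k)) i) atTop (𝓝 (var Z i)) := fun i =>
    (tendsto_pi_nhds.1 hZlim) (Sum.inr i)
  have hw : ∀ i, Tendsto (fun k => slk (X (φ k)) i) atTop (𝓝 (slk Z i)) := fun i =>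
    (tendsto_pi_nhds.1 hZlim) (Sum.inl i)
  have hri := tendsto_pi_nhds.1 hrlim
  have heqs : SatisfiesEqs A b c Z := isClosed_satisfiesEqs.mem_of_tendsto hZlim
    (Eventually.of_forall fun k => (hX (φ k)).1.1.1)
  have hv0 : ∀ i, 0 ≤ var Z i := fun i => ge_of_tendsto' (hv i) fun k => (hX (φ k)).1.1.2.1 i
  have hw0 : ∀ i, 0 ≤ slk Z i := fun i => ge_of_tendsto' (hw i) fun k => (hX (φ k)).1.1.2.2 i
  have hmu : mu Z = 0 := by
    rw [mu_eq heqs]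
    refine tendsto_nhds_unique (hv _) (hμφ.congr fun k => mu_eq (hX (φ k)).1.1.1)
  have hprod : ∀ i, var Z i * slk Z i = 0 := by
    have h := sum_var_mul_slk_eq_mu Z
    rw [hmu, mul_zero, Finset.sum_eq_zero_iff_of_nonneg
      fun i _ => mul_nonneg (hv0 i) (hw0 i)] at h
    exact fun i => h i (Finset.mem_univ i)
  refine ⟨Z, ⟨heqs, hv0, hw0⟩, hmu, fun i => ⟨hprod i, ?_⟩⟩
  -- the limit of the weighted complementarity identity counts the positive coordinates
  have hquot : ∀ (a : ℝ) (f : ℕ → ℝ), Tendsto f atTop (𝓝 a) →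
      Tendsto (fun k => a / f k) atTop (𝓝 (if a = 0 then 0 else 1)) := fun a f hf => by
    split_ifs with h
    · simp [h]
    · have h1 := (tendsto_const_nhds (x := a)).div hf h
      rw [div_self h] at h1
      exact h1
  -- This is the cross identity divided by `μ`, using `w_i / μ = r_i / z_i` and `z_i / μ = r_i /
  -- w_i`.
  have hid : ∀ k, ∑ i, (var Z i / var (X (φ k)) i + slk Z i / slk (X (φ k)) i) * r (φ k) i =
      dim m n := fun k => by
    have h := sum_cross (hX (φ k)).1.1.1 heqs hmu
    have hp := hμpos (φ k)
    rw [← div_eq_iff hp.ne', Finset.sum_div] at h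
    rw [← h]
    refine Finset.sum_congr rfl fun i _ => ?_
    have h1 := ((hX (φ k)).1.2.1 i).ne'
    have h2 := ((hX (φ k)).1.2.2 i).ne'
    simp only [hr]
    field_simp
  have hsumr : ∀ k, ∑ i, r k i = dim m n := fun k => by
    simp only [hr]
    rw [← Finset.sum_div, sum_var_mul_slk_eq_mu, mul_div_cancel_right₀ _ (hμpos k).ne']
  have hsumr' : ∑ i, r' i = dim m n :=
    tendsto_nhds_unique (tendsto_finsetSum _ fun i _ => hri i)
      (by simp only [hsumr]; exact tendsto_const_nhds)
  have hsum : ∑ i, ((if var Z i = 0 then 0 else 1) + (if slk Z i = 0 then 0 else 1)) * r' i =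
      dim m n :=
    tendsto_nhds_unique (tendsto_finsetSum _ fun i _ =>
      ((hquot _ _ (hv i)).add (hquot _ _ (hw i))).mul (hri i))
      (by simp only [hid]; exact tendsto_const_nhds)
  have hr'pos : ∀ i, 0 < r' i := fun i =>
    lt_of_lt_of_le (by linarith) (ge_of_tendsto' (hri i) fun k => (hrb (φ k) i).1)
  -- Complementarity makes each count of positive members at most 1, while the weighted counts and
  -- the positive weights have the same sum; hence every count is 1.
  rw [← hsumr', ← sub_eq_zero, ← neg_eq_zero, neg_sub, ← Finset.sum_sub_distrib,
    Finset.sum_eq_zero_iff_of_nonneg] at hsum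
  · by_contra hneg
    have h1 : var Z i = 0 := le_antisymm (by linarith [hw0 i]) (hv0 i)
    have h2 : slk Z i = 0 := le_antisymm (by linarith [hv0 i]) (hw0 i)
    have h3 := hsum i (Finset.mem_univ i)
    rw [if_pos h1, if_pos h2] at h3
    linarith [hr'pos i]
  · intro j _
    have hp := hr'pos j
    rcases mul_eq_zero.1 (hprod j) with h | h <;> rw [if_pos h] <;> split_ifs <;> linarith

end Embedding

end SelfDual

noncomputable section

namespace SelfDual

/-! ### The optimal partition for integral data, and rounding. -/

section Embedding

variable {m n : ℕ} (A : Matrix (Fin m) (Fin n) ℝ) (b : Fin m → ℝ) (c : Fin n → ℝ)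

/-- The constraint matrix `[I, -M]` acting on `(w; z)`. -/
def conMatrix : Matrix (Idx m n) (Idx m n ⊕ Idx m n) ℝ := Matrix.fromCols 1 (-sdMatrix A b c)

/-- A bound for the row sums of `conMatrix`, with one unit to spare. -/
def rowBound (p : Idx m n) : ℝ := 2 + ∑ q, |sdMatrix A b c p q|

/-- A bound for the minors of `conMatrix`. -/
def minorBound : ℝ := ∏ p, rowBound A b c p

variable {A b c} {θ : ℝ}

lemma satisfiesEqs_iff {Z : Point m n} :
    SatisfiesEqs A b c Z ↔ (conMatrix A b c).mulVec Z = sdRhs m n := by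
  have h : (conMatrix A b c).mulVec Z = slk Z - (sdMatrix A b c).mulVec (var Z) := by
    conv_lhs => rw [show Z = Sum.elim (slk Z) (var Z) from by ext (i | i) <;> rfl]
    rw [conMatrix, Matrix.fromCols_mulVec_sumElim, Matrix.one_mulVec, Matrix.neg_mulVec,
      sub_eq_add_neg]
  rw [h, SatisfiesEqs, sub_eq_iff_eq_add, add_comm]

lemma sum_abs_conMatrix (p : Idx m n) :
    ∑ q, |conMatrix A b c p q| + 1 ≤ rowBound A b c p := by
  have h : ∑ i, |(1 : Matrix (Idx m n) (Idx m n) ℝ) p i| = 1 := by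
    rw [Finset.sum_eq_single p (fun i _ hi => by simp [Matrix.one_apply_ne hi.symm])
      (fun h => absurd (Finset.mem_univ p) h)]
    simp
  rw [Fintype.sum_sum_type]
  simp only [conMatrix, Matrix.fromCols_apply_inl, Matrix.fromCols_apply_inr, Matrix.neg_apply,
    abs_neg, h, rowBound]
  linarith

lemma one_le_rowBound (p : Idx m n) : 1 ≤ rowBound A b c p :=
  one_le_of_row_bound sum_abs_conMatrix p

lemma rowBound_le_minorBound (p : Idx m n) : rowBound A b c p ≤ minorBound A b c := by
  have h := prod_comp_le_prod (f := fun _ : Unit => p) (fun _ _ _ => rfl)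
    (one_le_rowBound (A := A) (b := b) (c := c))
  rwa [Fintype.prod_unique] at h

lemma one_le_minorBound : 1 ≤ minorBound A b c :=
  (one_le_rowBound (iGam m n)).trans (rowBound_le_minorBound _)

/-- The data are integral. -/
def IntegralData (A : Matrix (Fin m) (Fin n) ℝ) (b : Fin m → ℝ) (c : Fin n → ℝ) : Prop :=
  ∃ (Ai : Matrix (Fin m) (Fin n) ℤ) (bi : Fin m → ℤ) (ci : Fin n → ℤ),
    (∀ i j, A i j = Ai i j) ∧ (∀ i, b i = bi i) ∧ ∀ j, c j = ci j

lemma exists_int_sdMatrix (h : IntegralData A b c) (p q : Idx m n) :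
    ∃ k : ℤ, sdMatrix A b c p q = k := by
  obtain ⟨Ai, bi, ci, hA, hb, hc⟩ := h
  have hbb : ∀ i, ∃ k : ℤ, bBar A b i = k := fun i =>
    ⟨bi i - ∑ j, Ai i j + 1, by simp [bBar, hA, hb]⟩
  have hcb : ∀ j, ∃ k : ℤ, cBar A c j = k := fun j =>
    ⟨(∑ i, Ai i j) + 1 - ci j, by simp [cBar, hA, hc]⟩
  have hob : ∃ k : ℤ, oBar b c = k := ⟨1 + (∑ j, ci j) - ∑ i, bi i, by simp [oBar, hb, hc]⟩
  have hneg : ∀ {x : ℝ}, (∃ k : ℤ, x = k) → ∃ k : ℤ, -x = k := fun ⟨k, hk⟩ =>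
    ⟨-k, by simp [hk]⟩
  rcases p with p | p | p | p <;> rcases q with q | q | q | q <;>
    simp only [sdMatrix, Matrix.of_apply] <;>
    first
      | exact ⟨0, Int.cast_zero.symm⟩
      | exact ⟨_, hA _ _⟩
      | exact ⟨_, hb _⟩
      | exact ⟨_, hc _⟩
      | exact hbb _
      | exact hcb _
      | exact hob
      | exact hneg ⟨_, hA _ _⟩
      | exact hneg ⟨_, hb _⟩
      | exact hneg ⟨_, hc _⟩
      | exact hneg (hbb _)
      | exact hneg (hcb _)
      | exact hneg hob

lemma exists_int_conMatrix (h : IntegralData A b c) :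
    ∃ Gi : Matrix (Idx m n) (Idx m n ⊕ Idx m n) ℤ,
      conMatrix A b c = Gi.map (fun t : ℤ => (t : ℝ)) := by
  choose Mi hMi using exists_int_sdMatrix h
  refine ⟨Matrix.fromCols 1 (-Matrix.of Mi), ?_⟩
  ext p (q | q)
  · simp [conMatrix, Matrix.one_apply]
  · simp [conMatrix, hMi]

lemma exists_int_sdRhs (p : Idx m n) : ∃ k : ℤ, sdRhs m n p = k :=
  ⟨if p = iGam m n then (n : ℤ) + m + 2 else 0, by unfold sdRhs dim; split_ifs <;> simp⟩

lemma mu_eq_zero_of_supp {Z P : Point m n} (hZ : SatisfiesEqs A b c Z) (hμ : mu Z = 0)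
    (hP : ∀ p, Z p = 0 → P p = 0) : var P (iGam m n) = 0 :=
  hP (Sum.inr (iGam m n)) ((mu_eq hZ).symm.trans hμ)

/-- Each coordinate that is positive in an optimal solution is not small in some optimal
solution with at most the same support. -/
lemma exists_optimal_coord_ge (hint : IntegralData A b c) {Z : Point m n}
    (hZ : Z ∈ feasible A b c) (hμ : mu Z = 0) {p : Idx m n ⊕ Idx m n} (hp : Z p ≠ 0) :
    ∃ P ∈ feasible A b c, mu P = 0 ∧ 1 / minorBound A b c ≤ P p := by
  obtain ⟨Gi, hGi⟩ := exists_int_conMatrix hint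
  choose qi hqi using exists_int_sdRhs (m := m) (n := n)
  have hZ0 : ∀ q, 0 ≤ Z q := fun q => (coord_le hZ q).1
  -- Such a `v` has zero `γ` entry, so adding it to the all-one point leaves `μ` unchanged.
  -- `sum_var_add_slk` then fixes the coordinate sum, which forces `v = 0`.
  have hrec : ∀ v : Point m n, (∀ q ∉ {q | Z q ≠ 0}, v q = 0) → (∀ q, 0 ≤ v q) →
      (conMatrix A b c).mulVec v = 0 → v = 0 := by
    intro v hvS hv0 hGv
    have hγ : var v (iGam m n) = 0 :=
      mu_eq_zero_of_supp hZ.1 hμ fun q hq => hvS q (not_not.2 hq)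
    have heqs : SatisfiesEqs A b c (ones m n + v) := by
      rw [satisfiesEqs_iff, Matrix.mulVec_add, hGv, add_zero]
      exact satisfiesEqs_iff.1 ones_satisfiesEqs
    have h1 := sum_var_add_slk heqs
    have h2 := sum_var_add_slk (ones_satisfiesEqs (A := A) (b := b) (c := c))
    have h3 : mu (ones m n + v) = mu (ones m n) := by
      rw [mu_eq heqs, mu_ones]
      simp only [var, ones, Pi.add_apply] at hγ ⊢
      rw [hγ, add_zero]
    rw [h3, ← h2] at h1
    simp only [var, slk, Pi.add_apply, Finset.sum_add_distrib] at h1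
    have h4 : ∑ q, v q = 0 := by
      rw [Fintype.sum_sum_type]; linarith
    rw [Finset.sum_eq_zero_iff_of_nonneg fun q _ => hv0 q] at h4
    exact funext fun q => h4 q (Finset.mem_univ q)
  obtain ⟨P, hP, hP0, hPS, hPp⟩ := exists_solution_coord_ge hGi sum_abs_conMatrix hqi
    (S := {q | Z q ≠ 0}) (x := Z) (c₀ := p) hrec (satisfiesEqs_iff.1 hZ.1) hZ0
    (fun q hq => not_not.1 hq) (lt_of_le_of_ne (hZ0 p) (Ne.symm hp))
  have hPe := satisfiesEqs_iff.2 hP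
  exact ⟨P, ⟨hPe, fun i => hP0 _, fun i => hP0 _⟩, (mu_eq hPe).trans
    (mu_eq_zero_of_supp hZ.1 hμ fun q hq => hPS q (not_not.2 hq)), hPp⟩

lemma coord_mul_swap_le {X P : Point m n} (hX : X ∈ feasible A b c) (hP : P ∈ feasible A b c)
    (hμ : mu P = 0) (p : Idx m n ⊕ Idx m n) : P p * X p.swap ≤ dim m n * mu X := by
  rw [← sum_cross hX.1 hP.1 hμ]
  have h1 : ∀ i, 0 ≤ var P i * slk X i := fun i => mul_nonneg (hP.2.1 i) (hX.2.2 i)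
  have h2 : ∀ i, 0 ≤ slk P i * var X i := fun i => mul_nonneg (hP.2.2 i) (hX.2.1 i)
  have h3 := fun i => Finset.single_le_sum (f := fun i => var P i * slk X i + slk P i * var X i)
    (fun i _ => add_nonneg (h1 i) (h2 i)) (Finset.mem_univ i)
  rcases p with i | i
  · exact (le_add_of_nonneg_left (h1 i)).trans (h3 i)
  · exact (le_add_of_nonneg_right (h2 i)).trans (h3 i)

/-- Use the optimal point whose coordinate `p` is at least `1/Δ`: its single term in the cross
identity bounds the partner `p.swap` of `p` in `X`. -/
lemma swap_le_of_supp (hint : IntegralData A b c) {X Z : Point m n} (hX : X ∈ feasible A b c)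
    (hZ : Z ∈ feasible A b c) (hμ : mu Z = 0) {p : Idx m n ⊕ Idx m n} (hp : Z p ≠ 0) :
    X p.swap ≤ dim m n * minorBound A b c * mu X := by
  obtain ⟨P, hP, hPμ, hPp⟩ := exists_optimal_coord_ge hint hZ hμ hp
  have hΔ : 0 < minorBound A b c := zero_lt_one.trans_le one_le_minorBound
  have h := (mul_le_mul_of_nonneg_right hPp (coord_le hX p.swap).1).trans
    (coord_mul_swap_le hX hP hPμ p)
  rw [one_div_mul_eq_div, div_le_iff₀ hΔ] at h
  linarith

/-- The product of partners is at least `(1 - θ) μ` and the other partner is `O(μ)`, so `μ` cancels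
and the lower bound does not degrade as `μ → 0`. -/
lemma le_of_supp (hint : IntegralData A b c) {X Z : Point m n} (hX : X ∈ nbhd A b c θ)
    (hZ : Z ∈ feasible A b c) (hμ : mu Z = 0) {p : Idx m n ⊕ Idx m n} (hp : Z p ≠ 0) :
    1 - θ ≤ dim m n * minorBound A b c * X p := by
  have h1 := swap_le_of_supp hint hX.1.1 hZ hμ hp
  have h2 : (1 - θ) * mu X ≤ X p * X p.swap := by
    rcases p with i | i
    · rw [mul_comm (X _)]; exact (ratio_bounds hX i).1
    · exact (ratio_bounds hX i).1
  have hμX := mu_pos_of_mem_nbhd hX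
  have h3 := h2.trans (mul_le_mul_of_nonneg_left h1 (coord_le hX.1.1 p).1)
  refine le_of_mul_le_mul_right (h3.trans (le_of_eq ?_)) hμX
  ring

/-- A point of the affine hull of the optimal face that is close to `X`. -/
lemma exists_close_point (hint : IntegralData A b c) {X Z : Point m n} (hX : X ∈ nbhd A b c θ)
    (hZ : Z ∈ feasible A b c) (hμ : mu Z = 0)
    (hsc : ∀ i, var Z i * slk Z i = 0 ∧ 0 < var Z i + slk Z i) :
    ∃ P : Point m n, SatisfiesEqs A b c P ∧ (∀ p, Z p = 0 → P p = 0) ∧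
      norm2 (P - X) ≤ 2 * dim m n ^ 2 * minorBound A b c ^ 3 * mu X := by
  classical
  obtain ⟨Gi, hGi⟩ := exists_int_conMatrix hint
  set Δ := minorBound A b c with hΔdef
  have hΔ1 : 1 ≤ Δ := one_le_minorBound
  have hN := dim_pos m n
  have hμX := mu_pos_of_mem_nbhd hX
  set δ := dim m n * Δ * mu X with hδ
  have hδ0 : 0 < δ := by positivity
  have hrest : ∀ p, Z p = 0 → |X p| ≤ δ := fun p hp => by
    rw [abs_of_nonneg (coord_le hX.1.1 p).1, ← Sum.swap_swap p]
    refine swap_le_of_supp hint hX.1.1 hZ hμ fun hs => ?_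
    rcases p with i | i
    · have := (hsc i).2
      simp only [var, slk, Sum.swap_inl] at this hs
      linarith
    · have := (hsc i).2
      simp only [var, slk, Sum.swap_inr] at this hs
      linarith
  -- Discard from `X` the coordinates outside the optimal support, each at most `δ`. The resulting
  -- defect in the equalities is at most `Δ δ` and equals the image of `Z - XS`, a vector on the
  -- support, so a small correction `d` there repairs it.
  set XS : Point m n := fun p => if Z p = 0 then 0 else X p with hXS
  set XR : Point m n := fun p => if Z p = 0 then X p else 0 with hXR
  have hsplit : XR + XS = X := by
    funext p; simp only [hXS, hXR, Pi.add_apply]; split_ifs <;> simp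
  have hGR : (conMatrix A b c).mulVec (Z - XS) = (conMatrix A b c).mulVec XR := by
    rw [Matrix.mulVec_sub, satisfiesEqs_iff.1 hZ.1, ← satisfiesEqs_iff.1 hX.1.1.1, ← hsplit,
      Matrix.mulVec_add, add_sub_cancel_right]
  have hXRle : ∀ p, |XR p| ≤ δ := fun p => by
    simp only [hXR]
    split_ifs with h
    · exact hrest p h
    · simpa using hδ0.le
  obtain ⟨d, hdS, hGd, hd⟩ := exists_small_solution hGi sum_abs_conMatrix
    (S := {q | Z q ≠ 0}) (x := Z - XS) (fun q hq => by
      have : Z q = 0 := not_not.1 hq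
      simp [hXS, this]) (ε := Δ * δ) (by positivity) (fun r => by
      rw [hGR]
      calc |(conMatrix A b c).mulVec XR r| ≤ ∑ q, |conMatrix A b c r q * XR q| :=
            Finset.abs_sum_le_sum_abs (fun q => conMatrix A b c r q * XR q) Finset.univ
        _ ≤ ∑ q, |conMatrix A b c r q| * δ := Finset.sum_le_sum fun q _ => by
            rw [abs_mul]
            exact mul_le_mul_of_nonneg_left (hXRle q) (abs_nonneg _)
        _ = (∑ q, |conMatrix A b c r q|) * δ := by rw [Finset.sum_mul]
        _ ≤ Δ * δ := by
            refine mul_le_mul_of_nonneg_right ?_ hδ0.le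
            linarith [sum_abs_conMatrix (A := A) (b := b) (c := c) r,
              rowBound_le_minorBound (A := A) (b := b) (c := c) r])
  change ∀ q, |d q| ≤ Δ * (Δ * δ) at hd
  refine ⟨XS + d, ?_, fun p hp => ?_, ?_⟩
  · rw [satisfiesEqs_iff, Matrix.mulVec_add, hGd, Matrix.mulVec_sub, add_sub_cancel]
    exact satisfiesEqs_iff.1 hZ.1
  · simp [hXS, hp, hdS p (not_not.2 hp)]
  · have hbound : ∀ p, |(XS + d - X) p| ≤ Δ * (Δ * δ) := fun p => by
      by_cases hp : Z p = 0
      · have h1 : (XS + d - X) p = -X p := by simp [hXS, hp, hdS p (not_not.2 hp)]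
        rw [h1, abs_neg]
        refine (hrest p hp).trans ?_
        rw [← mul_assoc]
        exact le_mul_of_one_le_left hδ0.le (one_le_mul_of_one_le_of_one_le hΔ1 hΔ1)
      · have h1 : (XS + d - X) p = d p := by simp [hXS, hp]
        rw [h1]
        exact hd p
    -- There are `2N` coordinates, each of size at most `Δ² δ = N Δ³ μ`.
    refine (norm2_le_card_mul (by positivity) hbound).trans (le_of_eq ?_)
    rw [Fintype.card_sum, Nat.cast_add, card_idx, hδ]
    ring

/-- When `μ` is small, the guessed face is the affine hull of the optimal face. -/
lemma guessedFace_eq (hint : IntegralData A b c) {X Z : Point m n} (hX : X ∈ nbhd A b c θ)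
    (hZ : Z ∈ feasible A b c) (hμ : mu Z = 0)
    (hsc : ∀ i, var Z i * slk Z i = 0 ∧ 0 < var Z i + slk Z i)
    (hsmall : dim m n ^ 2 * minorBound A b c ^ 2 * mu X < 1 - θ) :
    guessedFace A b c X = {P | SatisfiesEqs A b c P ∧ ∀ p, Z p = 0 → P p = 0} := by
  have hΔ : 0 < minorBound A b c := zero_lt_one.trans_le one_le_minorBound
  have hN := dim_pos m n
  -- The upper bound `N Δ μ` on the partner falls below the lower bound `(1 - θ)/(N Δ)`. Strict
  -- complementarity then makes the comparison of `z_i` and `w_i` decide which of them vanishes.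
  have hlt : ∀ p, Z p ≠ 0 → X p.swap < X p := fun p hp => by
    refine (swap_le_of_supp hint hX.1.1 hZ hμ hp).trans_lt ?_
    have h1 := le_of_supp hint hX hZ hμ hp
    refine lt_of_mul_lt_mul_left (a := dim m n * minorBound A b c) ?_ (by positivity)
    calc _ = dim m n ^ 2 * minorBound A b c ^ 2 * mu X := by ring
      _ < _ := hsmall.trans_le h1
  have hv : ∀ i, var Z i = 0 ↔ var X i ≤ slk X i := fun i => by
    constructor
    · intro h
      have h1 := (hsc i).2
      rw [h, zero_add] at h1
      exact (hlt (Sum.inl i) h1.ne').le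
    · intro h
      by_contra h1
      exact absurd (hlt (Sum.inr i) h1) (not_lt.2 h)
  have hw : ∀ i, slk Z i = 0 ↔ slk X i < var X i := fun i => by
    constructor
    · intro h
      have h1 := (hsc i).2
      rw [h, add_zero] at h1
      exact hlt (Sum.inr i) h1.ne'
    · intro h
      by_contra h1
      exact absurd (hlt (Sum.inl i) h1) (not_lt.2 h.le)
  ext P
  refine and_congr_right fun _ => ⟨fun h p hp => ?_, fun h i => ⟨fun hi => ?_, fun hi => ?_⟩⟩
  · rcases p with i | i
    · exact (h i).2 ((hw i).1 hp)
    · exact (h i).1 ((hv i).1 hp)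
  · exact h (Sum.inr i) ((hv i).2 hi)
  · exact h (Sum.inl i) ((hw i).2 hi)

/-- Rounding a point of the neighbourhood with small `μ` gives a strictly complementary optimal
solution. -/
lemma rounding_isStrictOptimal (hint : IntegralData A b c) {X Z : Point m n}
    (hX : X ∈ nbhd A b c θ)
    (hZ : Z ∈ feasible A b c) (hμ : mu Z = 0)
    (hsc : ∀ i, var Z i * slk Z i = 0 ∧ 0 < var Z i + slk Z i)
    (hsmall : 2 * dim m n ^ 3 * minorBound A b c ^ 4 * mu X < 1 - θ) :
    ∃ P : Point m n, IsRounding A b c X P ∧ (∀ Q, IsRounding A b c X Q → Q = P) ∧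
      IsStrictOptimal A b c P ∧ var P (iGam m n) = 0 := by
  have hΔ1 : 1 ≤ minorBound A b c := one_le_minorBound
  have hΔ : 0 < minorBound A b c := zero_lt_one.trans_le hΔ1
  have hN := dim_pos m n
  have hN2 := two_le_dim m n
  have hμX := mu_pos_of_mem_nbhd hX
  have hface := guessedFace_eq hint hX hZ hμ hsc (by
    refine lt_of_le_of_lt (mul_le_mul_of_nonneg_right ?_ hμX.le) hsmall
    refine mul_le_mul ?_ (pow_le_pow_right₀ hΔ1 (by norm_num)) (by positivity) (by positivity)
    have : dim m n ^ 2 ≤ dim m n ^ 3 := pow_le_pow_right₀ (by linarith) (by norm_num)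
    linarith [pow_pos hN 3])
  have hclosed : IsClosed (guessedFace A b c X) := by
    rw [hface, Set.ofPred_and]
    refine isClosed_satisfiesEqs.inter ?_
    simp only [Set.ofPred_forall]
    exact isClosed_iInter fun p => isClosed_iInter fun _ =>
      isClosed_eq (continuous_apply p) continuous_const
  have hmid : ∀ P ∈ guessedFace A b c X, ∀ Q ∈ guessedFace A b c X,
      (fun p => (P p + Q p) / 2) ∈ guessedFace A b c X := by
    rw [hface]
    rintro P ⟨hP, hP0⟩ Q ⟨hQ, hQ0⟩
    refine ⟨?_, fun p hp => by
      simp only [hP0 p hp, hQ0 p hp]; norm_num⟩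
    rw [satisfiesEqs_iff] at hP hQ ⊢
    have : (fun p => (P p + Q p) / 2) = (1 / 2 : ℝ) • (P + Q) := by
      funext p; simp only [Pi.smul_apply, Pi.add_apply, smul_eq_mul]; ring
    rw [this, Matrix.mulVec_smul, Matrix.mulVec_add, hP, hQ]
    funext i; simp only [Pi.smul_apply, Pi.add_apply, smul_eq_mul]; ring
  obtain ⟨P', hP'e, hP'0, hP'X⟩ := exists_close_point hint hX hZ hμ hsc
  have hP'mem : P' ∈ guessedFace A b c X := by rw [hface]; exact ⟨hP'e, hP'0⟩
  obtain ⟨P, hP, hPmin⟩ := exists_nearest hclosed ⟨P', hP'mem⟩ X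
  have hPX := (hPmin P' hP'mem).trans hP'X
  have hPf := hP
  rw [hface] at hPf
  obtain ⟨hPe, hP0⟩ := hPf
  -- The projection moves `X` no farther than `P'` is away, which is less than the lower bound on
  -- supported coordinates. Nonnegativity is thus derived, though the affine face does not impose
  -- it.
  have hpos : ∀ p, Z p ≠ 0 → 0 < P p := fun p hp => by
    have h1 := (abs_le.1 ((abs_le_norm2 (P - X) p).trans hPX)).1
    have h2 := le_of_supp hint hX hZ hμ hp
    rw [Pi.sub_apply] at h1
    have hNΔ : 0 < dim m n * minorBound A b c := by positivity
    have h3 : dim m n * minorBound A b c * (2 * dim m n ^ 2 * minorBound A b c ^ 3 * mu X) <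
        dim m n * minorBound A b c * X p := by
      calc _ = 2 * dim m n ^ 3 * minorBound A b c ^ 4 * mu X := by ring
        _ < _ := hsmall.trans_le h2
    linarith [lt_of_mul_lt_mul_left h3 hNΔ.le]
  have hnonneg : ∀ p, 0 ≤ P p := fun p => by
    by_cases hp : Z p = 0
    · rw [hP0 p hp]
    · exact (hpos p hp).le
  have hγ : var P (iGam m n) = 0 := mu_eq_zero_of_supp hZ.1 hμ hP0
  refine ⟨P, ⟨hP, hPmin⟩, fun Q hQ => nearest_unique hmid hP hQ.1 hPmin hQ.2,
    ⟨⟨hPe, fun i => hnonneg _, fun i => hnonneg _⟩, fun Q hQ => ?_, fun i => ?_⟩, hγ⟩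
  · rw [hγ, mul_zero]
    exact mul_nonneg hN.le (hQ.2.1 _)
  · obtain ⟨h1, h2⟩ := hsc i
    rcases mul_eq_zero.1 h1 with h | h
    · rw [h, zero_add] at h2
      have h3 : var P i = 0 := hP0 (Sum.inr i) h
      rw [h3, zero_mul, zero_add]
      exact ⟨rfl, hpos (Sum.inl i) h2.ne'⟩
    · rw [h, add_zero] at h2
      have h3 : slk P i = 0 := hP0 (Sum.inl i) h
      rw [h3, mul_zero, add_zero]
      exact ⟨rfl, hpos (Sum.inr i) h2.ne'⟩

end Embedding

end SelfDual

end

namespace SelfDual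

/-! ### Minors bounded by the binary length. -/

section Size

variable {m n : ℕ}

/-- From `1 + s + t ≤ (1 + s)(1 + t)`: sums of entries turn into sums of bit lengths. -/
lemma one_add_add_le_two_pow {s t : ℝ} {p q : ℕ} (hs : 0 ≤ s) (ht : 0 ≤ t)
    (hsp : 1 + s ≤ 2 ^ p) (htq : 1 + t ≤ 2 ^ q) : 1 + (s + t) ≤ 2 ^ (p + q) := by
  rw [pow_add]
  refine le_trans ?_ (mul_le_mul hsp htq (by linarith) (by positivity))
  nlinarith [mul_nonneg hs ht]

lemma one_add_sum_le_two_pow {ι : Type*} (s : Finset ι) {x : ι → ℝ} {k : ι → ℕ}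
    (hx : ∀ i, 0 ≤ x i) (h : ∀ i, 1 + x i ≤ 2 ^ k i) :
    1 + ∑ i ∈ s, x i ≤ 2 ^ (∑ i ∈ s, k i) := by
  classical
  induction s using Finset.induction_on with
  | empty => simp
  | insert i s hi ih =>
    rw [Finset.sum_insert hi, Finset.sum_insert hi]
    exact one_add_add_le_two_pow (hx i) (Finset.sum_nonneg fun j _ => hx j) (h i) ih

lemma one_add_abs_le_two_pow_clog (t : ℤ) :
    1 + |(t : ℝ)| ≤ 2 ^ Nat.clog 2 (t.natAbs + 1) := by
  have h := Nat.le_pow_clog (b := 2) (by norm_num) (t.natAbs + 1)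
  have h1 : ((t.natAbs : ℕ) : ℝ) = |(t : ℝ)| := by
    rw [Nat.cast_natAbs, Int.cast_abs]
  rw [← h1, add_comm]
  exact_mod_cast h

lemma one_add_le_two_pow (k : ℕ) : (k : ℝ) + 1 ≤ 2 ^ k := by
  exact_mod_cast Nat.lt_two_pow_self (n := k)

lemma dim_le_two_pow (hn : 0 < n) {L : ℕ} (hL : m + n ≤ L) : dim m n ≤ 2 ^ (2 * L) := by
  calc dim m n = ((m + n + 1 : ℕ) : ℝ) + 1 := by unfold dim; push_cast; ring
    _ ≤ 2 ^ (m + n + 1) := one_add_le_two_pow _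
    _ ≤ 2 ^ (2 * L) := pow_le_pow_right₀ (by norm_num) (by omega)

/-- The minors of the constraint matrix are bounded in terms of the binary length of the data. -/
lemma minorBound_le {A : Matrix (Fin m) (Fin n) ℝ} {b : Fin m → ℝ} {c : Fin n → ℝ}
    (hn : 0 < n) {Ai : Matrix (Fin m) (Fin n) ℤ} {bi : Fin m → ℤ} {ci : Fin n → ℤ}
    (hA : ∀ i j, A i j = Ai i j) (hb : ∀ i, b i = bi i) (hc : ∀ j, c j = ci j) :
    minorBound A b c ≤ 2 ^ (7 * binaryLength Ai bi ci) := by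
  set α : Fin m → Fin n → ℕ := fun i j => Nat.clog 2 ((Ai i j).natAbs + 1) with hα
  set β : Fin m → ℕ := fun i => Nat.clog 2 ((bi i).natAbs + 1) with hβ
  set γ : Fin n → ℕ := fun j => Nat.clog 2 ((ci j).natAbs + 1) with hγ
  have hA1 : ∀ i j, 1 + |A i j| ≤ 2 ^ α i j := fun i j => by
    rw [hA]; exact one_add_abs_le_two_pow_clog _
  have hb1 : ∀ i, 1 + |b i| ≤ 2 ^ β i := fun i => by
    rw [hb]; exact one_add_abs_le_two_pow_clog _
  have hc1 : ∀ j, 1 + |c j| ≤ 2 ^ γ j := fun j => by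
    rw [hc]; exact one_add_abs_le_two_pow_clog _
  have hrow : ∀ i, 1 + ∑ j, |A i j| ≤ 2 ^ ∑ j, α i j := fun i =>
    one_add_sum_le_two_pow _ (fun j => abs_nonneg _) (hA1 i)
  have hcol : ∀ j, 1 + ∑ i, |A i j| ≤ 2 ^ ∑ i, α i j := fun j =>
    one_add_sum_le_two_pow _ (fun i => abs_nonneg _) fun i => hA1 i j
  have hrow0 : ∀ i, 0 ≤ ∑ j, |A i j| := fun i => Finset.sum_nonneg fun _ _ => abs_nonneg _
  have hcol0 : ∀ j, 0 ≤ ∑ i, |A i j| := fun j => Finset.sum_nonneg fun _ _ => abs_nonneg _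
  have hall : 1 + ∑ i, ∑ j, |A i j| ≤ 2 ^ ∑ i, ∑ j, α i j :=
    one_add_sum_le_two_pow _ hrow0 hrow
  have hbs : 1 + ∑ i, |b i| ≤ 2 ^ ∑ i, β i :=
    one_add_sum_le_two_pow _ (fun i => abs_nonneg _) hb1
  have hcs : 1 + ∑ j, |c j| ≤ 2 ^ ∑ j, γ j :=
    one_add_sum_le_two_pow _ (fun i => abs_nonneg _) hc1
  have hall0 : 0 ≤ ∑ i, ∑ j, |A i j| := Finset.sum_nonneg fun i _ => hrow0 i
  have hbs0 : 0 ≤ ∑ i, |b i| := Finset.sum_nonneg fun _ _ => abs_nonneg _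
  have hcs0 : 0 ≤ ∑ j, |c j| := Finset.sum_nonneg fun _ _ => abs_nonneg _
  have hbBar : ∀ i, |bBar A b i| ≤ |b i| + ∑ j, |A i j| + 1 := fun i => by
    unfold bBar
    refine (abs_add_le _ _).trans (add_le_add ((abs_sub _ _).trans (add_le_add le_rfl
      (Finset.abs_sum_le_sum_abs _ _))) (by simp))
  have hcBar : ∀ j, |cBar A c j| ≤ ∑ i, |A i j| + 1 + |c j| := fun j => by
    unfold cBar
    refine (abs_sub _ _).trans (add_le_add ((abs_add_le _ _).trans (add_le_add
      (Finset.abs_sum_le_sum_abs _ _) (by simp))) le_rfl)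
  have hoBar : |oBar b c| ≤ 1 + ∑ j, |c j| + ∑ i, |b i| := by
    unfold oBar
    refine (abs_sub _ _).trans (add_le_add ((abs_add_le _ _).trans (add_le_add (by simp)
      (Finset.abs_sum_le_sum_abs _ _))) (Finset.abs_sum_le_sum_abs _ _))
  have h4 : ∀ (t : ℝ) (k : ℕ), 1 + t ≤ 2 ^ k → 4 * (1 + t) ≤ 2 ^ (2 + k) := fun t k h => by
    rw [pow_add]; linarith
  have h1 : ∀ i : Fin m, rowBound A b c (Sum.inl i) ≤ 2 ^ (2 + (∑ j, α i j + β i)) := fun i => by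
    refine le_trans ?_ (h4 _ _ (one_add_add_le_two_pow (hrow0 i) (abs_nonneg (b i))
      (hrow i) (hb1 i)))
    have : rowBound A b c (Sum.inl i) = 2 + (∑ j, |A i j| + (|b i| + |bBar A b i|)) := by
      simp [rowBound, sdMatrix]
    rw [this]
    linarith [hbBar i, hrow0 i, abs_nonneg (b i)]
  have h2 : ∀ j : Fin n, rowBound A b c (Sum.inr (Sum.inl j)) ≤
      2 ^ (2 + (∑ i, α i j + γ j)) := fun j => by
    refine le_trans ?_ (h4 _ _ (one_add_add_le_two_pow (hcol0 j) (abs_nonneg (c j))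
      (hcol j) (hc1 j)))
    have : rowBound A b c (Sum.inr (Sum.inl j)) =
        2 + (∑ i, |A i j| + (|c j| + |cBar A c j|)) := by
      simp [rowBound, sdMatrix]
    rw [this]
    linarith [hcBar j, hcol0 j, abs_nonneg (c j)]
  have h3 : rowBound A b c (iTau m n) ≤ 2 ^ (2 + (∑ i, β i + ∑ j, γ j)) := by
    refine le_trans ?_ (h4 _ _ (one_add_add_le_two_pow hbs0 hcs0 hbs hcs))
    have : rowBound A b c (iTau m n) = 2 + (∑ i, |b i| + (∑ j, |c j| + |oBar b c|)) := by
      simp [rowBound, sdMatrix, iTau]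
    rw [this]
    linarith
  -- This row collects all barred data and so contains `m + n` ones. Its prefactor is `m + n + 3 ≤
  -- 2^(m + n + 2)`, where 4 is enough for the other rows.
  have h5 : rowBound A b c (iGam m n) ≤
      2 ^ (m + n + 2 + (∑ i, ∑ j, α i j + (∑ i, β i + ∑ j, γ j))) := by
    have h6 := one_add_add_le_two_pow hall0 (add_nonneg hbs0 hcs0) hall
      (one_add_add_le_two_pow hbs0 hcs0 hbs hcs)
    have h7 := one_add_le_two_pow (m + n + 2)
    rw [pow_add]
    refine le_trans ?_ (mul_le_mul h7 h6 (by linarith) (by positivity))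
    have : rowBound A b c (iGam m n) =
        2 + (∑ i, |bBar A b i| + (∑ j, |cBar A c j| + |oBar b c|)) := by
      simp [rowBound, sdMatrix, iGam]
    rw [this]
    have h8 : ∑ i, |bBar A b i| ≤ ∑ i, |b i| + ∑ i, ∑ j, |A i j| + m := by
      refine (Finset.sum_le_sum fun i _ => hbBar i).trans (le_of_eq ?_)
      simp [Finset.sum_add_distrib]
    have h9 : ∑ j, |cBar A c j| ≤ ∑ i, ∑ j, |A i j| + n + ∑ j, |c j| := by
      refine (Finset.sum_le_sum fun j _ => hcBar j).trans (le_of_eq ?_)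
      rw [Finset.sum_comm]
      simp [Finset.sum_add_distrib]
    have h10 : (0 : ℝ) ≤ ((m : ℝ) + n) * (∑ i, ∑ j, |A i j| + (∑ i, |b i| + ∑ j, |c j|)) := by
      positivity
    push_cast
    linarith
  have hm : ∏ i : Fin m, rowBound A b c (Sum.inl i) ≤
      2 ^ (∑ i, (2 + (∑ j, α i j + β i))) := by
    rw [← Finset.prod_pow_eq_pow_sum]
    exact Finset.prod_le_prod (fun i _ => zero_le_one.trans (one_le_rowBound _)) fun i _ => h1 i
  have hn' : ∏ j : Fin n, rowBound A b c (Sum.inr (Sum.inl j)) ≤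
      2 ^ (∑ j, (2 + (∑ i, α i j + γ j))) := by
    rw [← Finset.prod_pow_eq_pow_sum]
    exact Finset.prod_le_prod (fun i _ => zero_le_one.trans (one_le_rowBound _)) fun i _ => h2 i
  have h0 : ∀ p, 0 ≤ rowBound A b c p := fun p => zero_le_one.trans (one_le_rowBound p)
  have hprod : minorBound A b c = (∏ i : Fin m, rowBound A b c (Sum.inl i)) *
      ((∏ j : Fin n, rowBound A b c (Sum.inr (Sum.inl j))) *
        (rowBound A b c (iTau m n) * rowBound A b c (iGam m n))) := by
    simp [minorBound, iTau, iGam]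
  rw [hprod]
  calc _ ≤ (2 : ℝ) ^ (∑ i, (2 + (∑ j, α i j + β i))) * (2 ^ (∑ j, (2 + (∑ i, α i j + γ j))) *
        (2 ^ (2 + (∑ i, β i + ∑ j, γ j)) *
          2 ^ (m + n + 2 + (∑ i, ∑ j, α i j + (∑ i, β i + ∑ j, γ j))))) := by
        refine mul_le_mul hm (mul_le_mul hn' (mul_le_mul h3 h5 (h0 _) (by positivity))
          (mul_nonneg (h0 _) (h0 _)) (by positivity)) ?_ (by positivity)
        exact mul_nonneg (Finset.prod_nonneg fun _ _ => h0 _) (mul_nonneg (h0 _) (h0 _))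
    _ ≤ _ := by
        rw [← pow_add, ← pow_add, ← pow_add]
        refine pow_le_pow_right₀ (by norm_num) ?_
        -- The exponents add up to `3(m + n) + 4` plus three times the bit lengths of the entries;
        -- as `n ≥ 1`, the 4 is absorbed by `4(m + n)`, whence the factor 7.
        have hcomm : ∑ j, ∑ i, α i j = ∑ i, ∑ j, α i j := Finset.sum_comm
        simp only [Finset.sum_add_distrib, Finset.sum_const, Finset.card_univ, Fintype.card_fin,
          smul_eq_mul, hcomm]
        have hL : binaryLength Ai bi ci =
          m * n + m + n + ∑ i, ∑ j, α i j + ∑ j, γ j + ∑ i, β i := rfl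
        rw [hL]
        generalize ∑ i, ∑ j, α i j = a
        generalize ∑ i, β i = b'
        generalize ∑ j, γ j = c'
        generalize m * n = d
        omega

lemma add_le_binaryLength (Ai : Matrix (Fin m) (Fin n) ℤ) (bi : Fin m → ℤ) (ci : Fin n → ℤ) :
    m + n ≤ binaryLength Ai bi ci := by
  unfold binaryLength
  generalize m * n = d
  omega

end Size

/-! ### From the embedding back to the primal–dual pair. -/

section Duality

variable {m n : ℕ} {A : Matrix (Fin m) (Fin n) ℝ} {b : Fin m → ℝ} {c : Fin n → ℝ}
  {P : Point m n}

lemma mulVec_xPart_ge (hP : P ∈ feasible A b c) (hγ : var P (iGam m n) = 0) (i : Fin m) :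
    b i * var P (iTau m n) ≤ A.mulVec (xPart P) i := by
  have h := satisfiesEqs_apply hP.1 (Sum.inl i)
  have h0 := hP.2.2 (Sum.inl i)
  simp only [iGam, iTau] at hγ ⊢
  simp [Matrix.mulVec, dotProduct, sdMatrix, sdRhs, iGam, hγ] at h
  simp only [Matrix.mulVec, dotProduct, xPart]
  linarith

lemma transpose_mulVec_yPart_le (hP : P ∈ feasible A b c) (hγ : var P (iGam m n) = 0)
    (j : Fin n) : A.transpose.mulVec (yPart P) j ≤ c j * var P (iTau m n) := by
  have h := satisfiesEqs_apply hP.1 (Sum.inr (Sum.inl j))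
  have h0 := hP.2.2 (Sum.inr (Sum.inl j))
  simp only [iGam, iTau] at hγ ⊢
  simp [Matrix.mulVec, dotProduct, sdMatrix, sdRhs, iGam, hγ] at h
  simp only [Matrix.mulVec, dotProduct, yPart, Matrix.transpose_apply]
  linarith

lemma slk_iTau (hP : P ∈ feasible A b c) (hγ : var P (iGam m n) = 0) :
    slk P (iTau m n) = b ⬝ᵥ yPart P - c ⬝ᵥ xPart P := by
  have h := satisfiesEqs_apply hP.1 (iTau m n)
  simp only [iGam] at hγ
  simp [Matrix.mulVec, dotProduct, sdMatrix, sdRhs, iGam, iTau, hγ] at h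
  simp only [dotProduct, xPart, yPart, iTau]
  linarith

lemma dotProduct_mulVec_eq (x : Fin n → ℝ) (y : Fin m → ℝ) :
    y ⬝ᵥ A.mulVec x = x ⬝ᵥ A.transpose.mulVec y := by
  rw [Matrix.dotProduct_mulVec, Matrix.mulVec_transpose, dotProduct_comm]

lemma dotProduct_le_of_le {k : ℕ} {u v w : Fin k → ℝ} (hu : ∀ i, 0 ≤ u i) (h : ∀ i, v i ≤ w i) :
    u ⬝ᵥ v ≤ u ⬝ᵥ w :=
  Finset.sum_le_sum fun i _ => mul_le_mul_of_nonneg_left (h i) (hu i)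

lemma weak_duality {x : Fin n → ℝ} {y : Fin m → ℝ} (hx : x ∈ primalFeasible A b)
    (hy : y ∈ dualFeasible A c) : b ⬝ᵥ y ≤ c ⬝ᵥ x := by
  calc b ⬝ᵥ y = y ⬝ᵥ b := dotProduct_comm _ _
    _ ≤ y ⬝ᵥ A.mulVec x := dotProduct_le_of_le hy.2 hx.1
    _ = x ⬝ᵥ A.transpose.mulVec y := dotProduct_mulVec_eq x y
    _ ≤ x ⬝ᵥ c := dotProduct_le_of_le hx.2 hy.1
    _ = c ⬝ᵥ x := dotProduct_comm _ _

/-- With `γ = 0` the rows of the embedding are homogeneous in `(x, y, τ)`. Scaling by `1/τ` gives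
feasible points, and `φ ≥ 0` closes the duality gap. -/
lemma optimal_of_tau_pos (hP : P ∈ feasible A b c) (hγ : var P (iGam m n) = 0)
    (hτ : 0 < var P (iTau m n)) :
    IsPrimalOptimal A b c (fun j => xPart P j / var P (iTau m n)) ∧
      IsDualOptimal A b c (fun i => yPart P i / var P (iTau m n)) := by
  set τ := var P (iTau m n)
  have hxe : (fun j => xPart P j / τ) = τ⁻¹ • xPart P := by
    funext j; simp [div_eq_inv_mul]
  have hye : (fun i => yPart P i / τ) = τ⁻¹ • yPart P := by
    funext j; simp [div_eq_inv_mul]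
  have hx : (fun j => xPart P j / τ) ∈ primalFeasible A b := by
    refine ⟨fun i => ?_, fun j => div_nonneg (hP.2.1 _) hτ.le⟩
    rw [hxe, Matrix.mulVec_smul, Pi.smul_apply, smul_eq_mul, ← div_eq_inv_mul, le_div_iff₀ hτ]
    exact mulVec_xPart_ge hP hγ i
  have hy : (fun i => yPart P i / τ) ∈ dualFeasible A c := by
    refine ⟨fun i => ?_, fun j => div_nonneg (hP.2.1 _) hτ.le⟩
    rw [hye, Matrix.mulVec_smul, Pi.smul_apply, smul_eq_mul, ← div_eq_inv_mul, div_le_iff₀ hτ]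
    exact transpose_mulVec_yPart_le hP hγ i
  have hgap : c ⬝ᵥ (fun j => xPart P j / τ) ≤ b ⬝ᵥ (fun i => yPart P i / τ) := by
    rw [hxe, hye, dotProduct_smul, dotProduct_smul]
    refine mul_le_mul_of_nonneg_left ?_ (inv_nonneg.2 hτ.le)
    linarith [slk_iTau hP hγ, hP.2.2 (iTau m n)]
  exact ⟨⟨hx, fun v hv => hgap.trans (weak_duality hv hy)⟩,
    ⟨hy, fun v hv => (weak_duality hx hv).trans hgap⟩⟩

/-- Here `Ax ≥ 0`, `Aᵀy ≤ 0` and `φ > 0` means `bᵀy > cᵀx`. Feasible points of both problems would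
force `cᵀx ≥ 0 ≥ bᵀy`. -/
lemma infeasible_of_tau_eq_zero (hP : P ∈ feasible A b c) (hγ : var P (iGam m n) = 0)
    (hτ : var P (iTau m n) = 0) (hφ : 0 < slk P (iTau m n)) :
    primalFeasible A b = ∅ ∨ dualFeasible A c = ∅ := by
  by_contra h
  rw [not_or, ← Ne, ← Ne, ← Set.nonempty_iff_ne_empty, ← Set.nonempty_iff_ne_empty] at h
  obtain ⟨⟨x, hx⟩, y, hy⟩ := h
  have h1 : 0 ≤ c ⬝ᵥ xPart P := by
    calc (0 : ℝ) = y ⬝ᵥ (0 : Fin m → ℝ) := (dotProduct_zero y).symm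
      _ ≤ y ⬝ᵥ A.mulVec (xPart P) := dotProduct_le_of_le hy.2 fun i => by
          simpa [hτ] using mulVec_xPart_ge hP hγ i
      _ = xPart P ⬝ᵥ A.transpose.mulVec y := dotProduct_mulVec_eq _ y
      _ ≤ xPart P ⬝ᵥ c := dotProduct_le_of_le (fun j => hP.2.1 _) hy.1
      _ = c ⬝ᵥ xPart P := dotProduct_comm _ _
  have h2 : b ⬝ᵥ yPart P ≤ 0 := by
    calc b ⬝ᵥ yPart P = yPart P ⬝ᵥ b := dotProduct_comm _ _
      _ ≤ yPart P ⬝ᵥ A.mulVec x := dotProduct_le_of_le (fun i => hP.2.1 _) hx.1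
      _ = x ⬝ᵥ A.transpose.mulVec (yPart P) := dotProduct_mulVec_eq x _
      _ ≤ x ⬝ᵥ (0 : Fin n → ℝ) := dotProduct_le_of_le hx.2 fun j => by
          simpa [hτ] using transpose_mulVec_yPart_le hP hγ j
      _ = 0 := dotProduct_zero x
  linarith [slk_iTau hP hγ]

end Duality

/-! ### The iteration count for exact solutions. -/

section Exact

variable {m n : ℕ} {A : Matrix (Fin m) (Fin n) ℝ} {b : Fin m → ℝ} {c : Fin n → ℝ}
  {θ : ℝ} {X : ℕ → Point m n}

/-- The factor `2 N³ Δ⁴` is at most `2^(L + 6L + 28L) = 2^(35L)`. Shrinking `μ` to `exp (-36L) ≤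
2^(-36L)` leaves at most `1/2 < 1 - θ`, and this takes `100 · 36 · √N L` iterations. -/
lemma run_mu_small (hθ : θ = 2 / 10 ∨ θ = 3 / 10) (hX : IsRun A b c θ X) (hμ : mu (X 0) ≤ 1)
    (hn : 0 < n) {Ai : Matrix (Fin m) (Fin n) ℤ} {bi : Fin m → ℤ} {ci : Fin n → ℤ}
    (hA : ∀ i j, A i j = Ai i j) (hb : ∀ i, b i = bi i) (hc : ∀ j, c j = ci j) {k : ℕ}
    (hk : 3600 * Real.sqrt (dim m n) * (binaryLength Ai bi ci : ℝ) ≤ k) :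
    2 * dim m n ^ 3 * minorBound A b c ^ 4 * mu (X k) < 1 - θ := by
  set L := binaryLength Ai bi ci
  have hL : m + n ≤ L := add_le_binaryLength Ai bi ci
  have hL1 : 1 ≤ L := by omega
  have hN := dim_pos m n
  have hΔ : 0 ≤ minorBound A b c := zero_le_one.trans one_le_minorBound
  have hμk : mu (X k) ≤ Real.exp (-(36 * L)) := by
    have h := run_mu_le_exp hθ hX (k := k) (t := 36 * L) (by linarith)
    exact h.trans (mul_le_of_le_one_right (Real.exp_pos _).le hμ)
  have hcoef : 2 * dim m n ^ 3 * minorBound A b c ^ 4 ≤ 2 ^ (35 * L) := by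
    calc 2 * dim m n ^ 3 * minorBound A b c ^ 4
        ≤ 2 ^ L * (2 ^ (2 * L)) ^ 3 * (2 ^ (7 * L)) ^ 4 := by
          refine mul_le_mul (mul_le_mul ?_ (pow_le_pow_left₀ hN.le (dim_le_two_pow hn hL) 3)
            (by positivity) (by positivity)) (pow_le_pow_left₀ hΔ (minorBound_le hn hA hb hc) 4)
            (by positivity) (by positivity)
          simpa using pow_le_pow_right₀ (one_le_two : (1 : ℝ) ≤ 2) hL1
      _ = 2 ^ (35 * L) := by
          rw [← pow_mul, ← pow_mul, ← pow_add, ← pow_add]; congr 1; ring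
  have he : (2 : ℝ) ≤ Real.exp 1 := by linarith [Real.add_one_le_exp (1 : ℝ)]
  have hexp : (2 : ℝ) ^ (36 * L) ≤ Real.exp (36 * L) := by
    calc (2 : ℝ) ^ (36 * L) ≤ Real.exp 1 ^ (36 * L) := pow_le_pow_left₀ (by norm_num) he _
      _ = Real.exp (36 * L) := by
          rw [← Real.exp_nat_mul]; push_cast; rw [mul_one]
  calc 2 * dim m n ^ 3 * minorBound A b c ^ 4 * mu (X k)
      ≤ 2 ^ (35 * L) * Real.exp (-(36 * L)) :=
        mul_le_mul hcoef hμk (mu_pos_of_mem_nbhd (run_mem_nbhd hθ hX k)).le (by positivity)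
    _ ≤ 1 / 2 := by
        rw [Real.exp_neg, ← div_eq_mul_inv, div_le_iff₀ (Real.exp_pos _)]
        have h2 : (2 : ℝ) ^ (35 * L) * 2 ≤ 2 ^ (36 * L) := by
          rw [← pow_succ]
          exact pow_le_pow_right₀ (by norm_num) (by omega)
        linarith
    _ < 1 - θ := by rcases hθ with rfl | rfl <;> norm_num

end Exact

end SelfDual

theorem mainTheorem2 :
    ∃ C : ℝ, 0 < C ∧
      ∀ (θ : ℝ), (θ = 2 / 10 ∨ θ = 3 / 10) →
      ∀ (m n : ℕ) (A : Matrix (Fin m) (Fin n) ℝ) (b : Fin m → ℝ) (c : Fin n → ℝ),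
        -- the all-one vector is a legitimate start with `μ = 1`, and the loop never gets stuck
        (SelfDual.ones m n ∈ SelfDual.nbhd A b c θ ∧ SelfDual.mu (SelfDual.ones m n) = 1 ∧
          ∀ Z ∈ SelfDual.nbhd A b c θ, ∃ Znext, SelfDual.Step A b c Z Znext) ∧
        ∀ X : ℕ → SelfDual.Point m n, SelfDual.IsRun A b c θ X →
          -- linear convergence of `μ` to zero
          (Tendsto (fun k => SelfDual.mu (X k)) atTop (𝓝 0) ∧
            ∀ k, SelfDual.mu (X (k + 1)) ≤
              (1 - (1 / 100) / Real.sqrt (SelfDual.dim m n)) * SelfDual.mu (X k)) ∧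
          -- all iterates stay in the neighborhood
          (∀ k, X k ∈ SelfDual.nbhd A b c θ) ∧
          -- iteration bounds, when `n + m + 2 ≤ κ n`
          ∀ κ : ℝ, (n : ℝ) + m + 2 ≤ κ * n →
            (∀ ζ : ℝ, 0 < ζ → ∀ k : ℕ,
              C * Real.sqrt κ * Real.sqrt n * Real.log (SelfDual.mu (X 0) / ζ) ≤ k →
                X k ∈ SelfDual.zetaOptimal A b c ζ) ∧
            (SelfDual.mu (X 0) ≤ 1 →
              (∀ ζ : ℝ, 0 < ζ → ∀ k : ℕ,
                C * Real.sqrt κ * Real.sqrt n * Real.log (1 / ζ) ≤ k →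
                  X k ∈ SelfDual.zetaOptimal A b c ζ) ∧
              -- exact solutions, for integer data
              ∀ (Ai : Matrix (Fin m) (Fin n) ℤ) (bi : Fin m → ℤ) (ci : Fin n → ℤ),
                (∀ i j, A i j = (Ai i j : ℝ)) → (∀ i, b i = (bi i : ℝ)) →
                (∀ j, c j = (ci j : ℝ)) → ∀ k : ℕ,
                C * Real.sqrt κ * Real.sqrt n * (SelfDual.binaryLength Ai bi ci : ℝ) ≤ k →
                  ∃ P : SelfDual.Point m n,
                    SelfDual.IsRounding A b c (X k) P ∧
                    (∀ Q, SelfDual.IsRounding A b c (X k) Q → Q = P) ∧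
                    SelfDual.IsStrictOptimal A b c P ∧
                    (0 < SelfDual.var P (SelfDual.iTau m n) →
                      SelfDual.IsPrimalOptimal A b c
                        (fun j => SelfDual.xPart P j / SelfDual.var P (SelfDual.iTau m n)) ∧
                      SelfDual.IsDualOptimal A b c
                        (fun i => SelfDual.yPart P i / SelfDual.var P (SelfDual.iTau m n))) ∧
                    (SelfDual.var P (SelfDual.iTau m n) = 0 →
                      SelfDual.primalFeasible A b = ∅ ∨ SelfDual.dualFeasible A c = ∅)) := by
  open SelfDual in
  refine ⟨3600, by norm_num, fun θ hθ m n A b c => ?_⟩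
  have hθ0 : 0 ≤ θ := by rcases hθ with rfl | rfl <;> norm_num
  have hθ1 : θ < 1 := by rcases hθ with rfl | rfl <;> norm_num
  refine ⟨⟨ones_mem_nbhd hθ0, mu_ones, fun Z hZ => exists_step hZ.1⟩, fun X hX => ?_⟩
  have hnb := run_mem_nbhd hθ hX
  have hlim := run_mu_tendsto hθ hX
  refine ⟨⟨hlim, run_mu_succ_le hθ hX⟩, hnb, fun κ hκ => ?_⟩
  obtain ⟨hn, hsqrt⟩ := sqrt_dim_le hκ
  -- the bound in terms of `√κ √n` dominates the one in terms of `√(n + m + 2)`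
  have hzeta : ∀ μ₀ : ℝ, mu (X 0) ≤ μ₀ → ∀ ζ : ℝ, 0 < ζ → ∀ k : ℕ,
      3600 * Real.sqrt κ * Real.sqrt n * Real.log (μ₀ / ζ) ≤ k →
        X k ∈ zetaOptimal A b c ζ := fun μ₀ hμ₀ ζ hζ k hk => by
    refine ⟨(hnb k).1.1, ?_⟩
    -- If `μ₀ ≤ ζ`, the logarithm is nonpositive and `√N` cannot be traded for the larger `√κ √n`;
    -- monotonicity of `μ` settles this case for every `k`.
    rcases le_or_gt μ₀ ζ with h | h
    · exact (run_mu_le_start hθ hX k).trans (hμ₀.trans h)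
    · have hlog : 0 ≤ Real.log (μ₀ / ζ) := Real.log_nonneg ((one_le_div hζ).2 h.le)
      refine run_mu_le_of_log_le hθ hX hζ hμ₀ ((mul_le_mul_of_nonneg_right ?_ hlog).trans hk)
      linarith [Real.sqrt_nonneg (dim m n)]
  refine ⟨hzeta _ le_rfl, fun hμ => ⟨hzeta 1 hμ, fun Ai bi ci hA hb hc k hk => ?_⟩⟩
  have hsmall := run_mu_small hθ hX hμ hn hA hb hc (k := k) (le_trans
    (mul_le_mul_of_nonneg_right (by linarith) (Nat.cast_nonneg _)) hk)
  obtain ⟨Z, hZ, hZμ, hsc⟩ := exists_strictly_complementary hθ1 hnb hlim (run_mu_le_start hθ hX)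
  obtain ⟨P, hP, huniq, hopt, hγ⟩ := rounding_isStrictOptimal ⟨Ai, bi, ci, hA, hb, hc⟩ (hnb k)
    hZ hZμ hsc hsmall
  refine ⟨P, hP, huniq, hopt, optimal_of_tau_pos hopt.1 hγ, fun hτ =>
    infeasible_of_tau_eq_zero hopt.1 hγ hτ ?_⟩
  -- Strict complementarity at `τ = 0` gives `φ > 0`, the certificate of infeasibility.
  have := (hopt.2.2 (iTau m n)).2
  rwa [hτ, zero_add] at this
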